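/- Let $\Theta\subseteq\mathbb R$ be a non-degenerate closed interval (the real line, a closed half-line or a compact interval) and $\mathbb R_+=[0,\infty)$. For every $n\ge 1$ let $\mathcal H_n=\{H^{n}_{j,2l-1}: 1\le j\le n+1,\ 1\le l\le 2^{j-1}\}$ be Borel probability measures on $\Theta$, each absolutely continuous with respect to Lebesgue measure and with support $\Theta$; let $P_\eta$ be a probability measure on $\mathbb R_+$ with support $\mathbb R_+$; and for every $m\ge1$ let $\alpha_m\in(0,\infty)^m$. For $n,m\ge1$, the law $\mathrm{DSBASg}(n,\mathcal H_n,P_\eta,m,\alpha_m)$ is the law of the random probability measure on $\Theta\times\mathbb R_+$ $$\sum_{l_1=1}^{2^n}\sum_{l_2=1}^{m} w^\theta_{n,l_1}\,w^\phi_{l_1,l_2}\,\delta_{(\theta_{l_1},\phi_{l_2})},\qquad \theta_l=\mu_{n+1,2l-1},\quad w^\theta_{n,l}=F_{n,l}-F_{n,l-1},$$ built as follows, with $\{\mu_{j,l}\}$, $(\phi_l)$ and $(w^\phi_{l,\cdot})$ independent. * With $\mu_{j,0}=\inf\Theta$ and $\mu_{j,2^j}=\sup\Theta$: $\mu_{1,1}\sim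 H^n_{1,1}$; for $2\le j\le n+1$, $\mu_{j,2l}=\mu_{j-1,l}$ for $1\le l\le 2^{j-1}-1$, and, given the levels below $j$, the points $\mu_{j,2l-1}$, $1\le l\le 2^{j-1}$, are independent with law $H^n_{j,2l-1}$ conditioned on $(\mu_{j-1,l-1},\mu_{j-1,l}]$. * $F_{0,0}=0$, $F_{0,1}=1$, and for $1\le j\le n$: $F_{j,2l}=F_{j-1,l}$ for $0\le l\le 2^{j-1}$, and $$F_{j,2l-1}=F_{j-1,l-1}+(F_{j-1,l}-F_{j-1,l-1})\,\frac{\mu_{j+1,4l-1}-\mu_{j+1,4l-2}}{\mu_{j+1,4l-1}-\mu_{j+1,4l-3}},\qquad 1\le l\le 2^{j-1}\quad(0/0:=1).$$ * $\phi_1,\dots,\phi_m$ are i.i.d. with law $P_\eta$, and $(w^\phi_{l,1},\dots,w^\phi_{l,m})$, $1\le l\le 2^n$, are i.i.d. with law $\mathrm{Dirichlet}(\alpha_m)$. Let $n$ and $m_2$ be random variables with values in $\{1,2,\dots\}$ whose joint law has full support, that is, $\mathbb P(n=a,\,m_2=b)>0$ for all integers $a,b\ge1$, and let $G$ be a random probability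 measure on $\Theta\times\mathbb R_+$ such that, conditionally on $n$ and $m_2$, $G\sim\mathrm{DSBASg}(n,\mathcal H_n,P_\eta,m_2,\alpha_{m_2})$. Then the support of the law of $G$ in the weak topology is the whole space $\mathcal P(\Theta\times\mathbb R_+)$ of Borel probability measures on $\Theta\times\mathbb R_+$; that is, $\mathbb P(G\in U)>0$ for every non-empty weakly open $U\subseteq\mathcal P(\Theta\times\mathbb R_+)$. -/

import Mathlib

open MeasureTheory ProbabilityTheory
open scoped NNReal ENNReal

noncomputable section

namespace DSBA

variable {Θ : Set ℝ}

/-- Row `j` of a sequential barycenter array in `Θ`: the `2 ^ j - 1` points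
`μ_{j,1}, …, μ_{j,2^j-1}`; the point `μ_{j,l}` sits at position `l - 1`. -/
abbrev Row (Θ : Set ℝ) (j : ℕ) : Type := Fin (2 ^ j - 1) → Θ

/-- The node `μ_{j,l}` of a row, as an extended real number, with the conventions
`μ_{j,0} = inf Θ` and `μ_{j,2^j} = sup Θ`. -/
def node {j : ℕ} (x : Row Θ j) (l : ℕ) : EReal :=
  if h : 1 ≤ l ∧ l < 2 ^ j then (((x ⟨l - 1, by omega⟩ : Θ) : ℝ) : EReal)
  else if l = 0 then sInf ((fun t : ℝ => (t : EReal)) '' Θ)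
  else sSup ((fun t : ℝ => (t : EReal)) '' Θ)

/-- The interval `(μ_{j,l-1}, μ_{j,l}]` of `Θ`, for `1 ≤ l ≤ 2 ^ j`. -/
def gap {j : ℕ} (x : Row Θ j) (l : ℕ) : Set Θ :=
  {t | node x (l - 1) < ((t : ℝ) : EReal) ∧ ((t : ℝ) : EReal) ≤ node x l}

/-- Row `j + 1` obtained from row `j` and the new odd-indexed points `y k = μ_{j+1,2k+1}`,
`0 ≤ k < 2 ^ j`: `μ_{j+1,2l} = μ_{j,l}` and `μ_{j+1,2l-1} = y (l - 1)`. Position `i` carries the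
index `i + 1`. -/
def interleave {j : ℕ} (x : Row Θ j) (y : Fin (2 ^ j) → Θ) : Row Θ (j + 1) := fun i =>
  if h : (i : ℕ) % 2 = 1 then
    x ⟨(i : ℕ) / 2, by have h1 := i.2; have h2 := pow_succ 2 j; omega⟩
  else
    y ⟨(i : ℕ) / 2, by have h1 := i.2; have h2 := pow_succ 2 j; omega⟩

/-- Law of row `j + 1` of the random barycenter array with parameters
`H j (2 l - 1) = H_{j,2l-1}`. Row `1` is `μ_{1,1} ∼ H_{1,1}`. Given row `j + 1`, the even-indexed
points of row `j + 2` are those of row `j + 1`, and its odd-indexed points `μ_{j+2,2l-1}`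
(`l = k + 1`) are independent, with law `H_{j+2,2l-1}` restricted to (that is, conditioned on)
the interval `(μ_{j+1,l-1}, μ_{j+1,l}]`. The row of level `n + 1` contains all earlier rows,
see `bary`. -/
def rowLaw (H : ℕ → ℕ → Measure Θ) : (j : ℕ) → Measure (Row Θ (j + 1))
  | 0 => (H 1 1).map fun t _ => t
  | j + 1 => (rowLaw H j).bind fun x =>
      (Measure.pi fun k : Fin (2 ^ (j + 1)) =>
        ProbabilityTheory.cond (H (j + 2) (2 * ((k : ℕ) + 1) - 1)) (gap x ((k : ℕ) + 1))).map
      (interleave x)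

/-- The point `μ_{j,l}`, `1 ≤ j ≤ n + 1`, `1 ≤ l ≤ 2 ^ j - 1`, of the array whose row of level
`n + 1` is `x`: since `μ_{j+1,2l} = μ_{j,l}`, it is the point of `x` with index
`2 ^ (n + 1 - j) * l`. -/
def bary {n : ℕ} (x : Row Θ (n + 1)) (j l : ℕ) : ℝ := (node x (2 ^ (n + 1 - j) * l)).toReal

/-- Division with the convention `0 / 0 = 1`. -/
def divOne (a b : ℝ) : ℝ := if a = 0 ∧ b = 0 then 1 else a / b

/-- The inversion formula: `cdfAt μ j l` is the value `G(μ_{j,l})` of the distribution function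
encoded by the array `μ`. Here `G(μ_{j,0}) = 0`, `G(μ_{j,2^j}) = 1`,
`G(μ_{j,2l}) = G(μ_{j-1,l})`, and, for `1 ≤ l ≤ 2 ^ (j - 1)`,
`G(μ_{j,2l-1}) = G(μ_{j-1,l-1}) + (G(μ_{j-1,l}) - G(μ_{j-1,l-1})) *
  (μ_{j+1,4l-1} - μ_{j+1,4l-2}) / (μ_{j+1,4l-1} - μ_{j+1,4l-3})`.
In the recursive clause the level is `j + 1`, and an odd index is `i = 2 l - 1` with
`l = i / 2 + 1`. -/
def cdfAt (μ : ℕ → ℕ → ℝ) : ℕ → ℕ → ℝ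
  | 0, i => if i = 0 then 0 else 1
  | j + 1, i =>
      if i % 2 = 0 then cdfAt μ j (i / 2)
      else
        let l := i / 2 + 1
        cdfAt μ j (l - 1) + (cdfAt μ j l - cdfAt μ j (l - 1)) *
          divOne (μ (j + 2) (4 * l - 1) - μ (j + 2) (4 * l - 2))
            (μ (j + 2) (4 * l - 1) - μ (j + 2) (4 * l - 3))

/-- The location weight `w^θ_{n,l} = G₁(Θ_{n,l}) = G₁(μ_{n,l}) - G₁(μ_{n,l-1})`,
`1 ≤ l ≤ 2 ^ n`, of the array whose row of level `n + 1` is `x`. -/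
def locWeight {n : ℕ} (x : Row Θ (n + 1)) (l : ℕ) : ℝ :=
  cdfAt (bary x) n l - cdfAt (bary x) n (l - 1)

/-- The location atom `θ_{k+1} = μ_{n+1,2(k+1)-1}`, `0 ≤ k < 2 ^ n`. -/
def locAtom {n : ℕ} (x : Row Θ (n + 1)) (k : Fin (2 ^ n)) : Θ :=
  x ⟨2 * (k : ℕ), by have := k.2; rw [pow_succ]; omega⟩

/-- The Dirichlet distribution with parameter `α` (positive entries): the law of
`(γ_1, …, γ_m) / (γ_1 + ⋯ + γ_m)` for independent `γ_i ∼ Gamma(α_i, 1)`. -/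
def dirichletMeasure {m : ℕ} (α : Fin m → ℝ) : Measure (Fin m → ℝ) :=
  (Measure.pi fun i => gammaMeasure (α i) 1).map fun g i => g i / ∑ k, g k

/-- The discrete measure
`∑_{l₁} ∑_{l₂} w^θ_{n,l₁} w^φ_{l₁,l₂} δ_{(θ_{l₁}, φ_{l₂})}` on `Θ × [0, ∞)`. -/
def discreteMeasure {n m : ℕ} (x : Row Θ (n + 1)) (φ : Fin m → ℝ≥0)
    (w : Fin (2 ^ n) → Fin m → ℝ) : Measure (Θ × ℝ≥0) :=
  ∑ k₁ : Fin (2 ^ n), ∑ k₂ : Fin m,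
    ENNReal.ofReal (locWeight x ((k₁ : ℕ) + 1) * w k₁ k₂) •
      Measure.dirac (locAtom x k₁, φ k₂)

/-- The law `DSBASg(n, H_n, η, m₂, α)` of the discrete SBA scale general random probability
measure, as a law on the measures on `Θ × [0, ∞)`: the barycenter array, the scale atoms
`φ_1, …, φ_{m₂}` (i.i.d. from `Pη`), and the scale weights `w^φ_{l,·}`, `l = 1, …, 2 ^ n`
(i.i.d. Dirichlet), are independent. -/
def dsbasgLaw (n : ℕ) (H : ℕ → ℕ → Measure Θ) (Pη : Measure ℝ≥0) (m : ℕ) (α : Fin m → ℝ) :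
    Measure (Measure (Θ × ℝ≥0)) :=
  ((rowLaw H n).prod
      ((Measure.pi fun _ : Fin m => Pη).prod
        (Measure.pi fun _ : Fin (2 ^ n) => dirichletMeasure α))).map
    fun p => discreteMeasure p.1 p.2.1 p.2.2

end DSBA

end

open MeasureTheory ProbabilityTheory Filter Topology
open scoped NNReal ENNReal BoundedContinuousFunction

/-! ### Positivity of the random barycenter array near strictly increasing rows. -/

namespace DSBA

variable {Θ : Set ℝ}

/-! The support is closed, so it suffices that it contains a weakly dense family. The family
consists of sequential barycenter discretizations: the gaps of level `n` of the barycenter array of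
a first marginal are collapsed to their barycenters, while finitely many scale values are kept
exactly.

Such discretizations lie in the support. For a fully supported marginal with no mass at `inf Θ`, the
array is strictly increasing, and the inversion formula returns exactly the masses of its gaps
(`cdfAt_sbaRow`). Splitting a gap at its barycenter `b` gives children with masses `m_L`, `m_R` and
barycenters `b_L < b < b_R`, and `m_L (b - b_L) = m_R (b_R - b)`, so the left child has the share
`(b_R - b) / (b_R - b_L)`. Hence each discretization is the image of a strict row, some scales and
some points of the simplex under the map that defines the random measure. All three lie in the
supports of their laws (`rowLaw_pos`, `mem_support_dirichletMeasure`), and at strict rows that map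
is continuous against test functions, since no denominator vanishes there. So the conditional law
given `n` and `m₂` charges every neighbourhood, and the event on which one conditions has positive
probability (`exists_measurableSet_dsbasgLaw_pos`).

Discretizations are dense. Against an `L`-Lipschitz function the error is at most `L` times the mean
absolute deviation from the barycenters. This tends to `0` for a finite second moment: it is
controlled by the drop of the within-gap variance from one level to the next, and these drops tend
to `0` because the variance decreases and is nonnegative (`tendsto_absDev`). An arbitrary measure is
first approximated by images under simple functions avoiding `inf Θ`, mixed with a vanishing
multiple of a regular measure at scale `0`; this makes the marginal regular and the scales finite in
number. -/

theorem node_zero {j : ℕ} (x : Row Θ j) :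
    node x 0 = sInf ((fun t : ℝ => (t : EReal)) '' Θ) := by
  simp [node]

theorem node_top {j : ℕ} (x : Row Θ j) :
    node x (2 ^ j) = sSup ((fun t : ℝ => (t : EReal)) '' Θ) := by
  simp [node]

theorem node_of_mem {j : ℕ} (x : Row Θ j) {l : ℕ} (h1 : 1 ≤ l) (h2 : l < 2 ^ j) :
    node x l = ((x ⟨l - 1, by omega⟩ : ℝ) : EReal) := by
  rw [node, dif_pos ⟨h1, h2⟩]

theorem node_interleave_even {j : ℕ} (x : Row Θ j) (y : Fin (2 ^ j) → Θ) (l : ℕ) :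
    node (interleave x y) (2 * l) = node x l := by
  have hp := pow_succ 2 j
  by_cases h : 1 ≤ l ∧ l < 2 ^ j
  · rw [node_of_mem _ (by omega) (by omega), node_of_mem _ h.1 h.2]
    have h1 : (2 * l - 1) % 2 = 1 := by omega
    have h2 : (2 * l - 1) / 2 = l - 1 := by omega
    simp [interleave, h1, h2]
  · rw [node, dif_neg (by omega), node, dif_neg h]
    by_cases h0 : l = 0 <;> simp [h0]

theorem node_interleave_odd {j : ℕ} (x : Row Θ j) (y : Fin (2 ^ j) → Θ) (k : Fin (2 ^ j)) :
    node (interleave x y) (2 * (k : ℕ) + 1) = ((y k : ℝ) : EReal) := by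
  have hp := pow_succ 2 j
  have := k.2
  rw [node_of_mem _ (by omega) (by omega)]
  simp [interleave]

theorem continuous_node {j : ℕ} (l : ℕ) : Continuous fun x : Row Θ j => node x l := by
  unfold node
  split_ifs
  · exact continuous_coe_real_ereal.comp (continuous_subtype_val.comp (continuous_apply _))
  · exact continuous_const
  · exact continuous_const

theorem continuous_interleave {j : ℕ} :
    Continuous fun p : Row Θ j × (Fin (2 ^ j) → Θ) => interleave p.1 p.2 := by
  refine continuous_pi fun i => ?_
  unfold interleave
  split_ifs
  · exact (continuous_apply _).comp continuous_fst
  · exact (continuous_apply _).comp continuous_snd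

theorem continuous_coe_ereal : Continuous fun t : Θ => ((t : ℝ) : EReal) :=
  continuous_coe_real_ereal.comp continuous_subtype_val

/-- Rows whose nodes, including the two endpoints of `Θ`, are strictly increasing. -/
def StrictRow {j : ℕ} (x : Row Θ j) : Prop := ∀ l < 2 ^ j, node x l < node x (l + 1)

theorem exists_eq_interleave {j : ℕ} (x : Row Θ (j + 1)) :
    ∃ (x' : Row Θ j) (y : Fin (2 ^ j) → Θ), interleave x' y = x := by
  have hp := pow_succ 2 j
  refine ⟨fun i => x ⟨2 * i + 1, by omega⟩, fun k => x ⟨2 * k, by omega⟩, funext fun i => ?_⟩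
  unfold interleave
  split_ifs <;> exact congrArg x (Fin.ext (by simp; omega))

theorem StrictRow.of_interleave {j : ℕ} {x : Row Θ j} {y : Fin (2 ^ j) → Θ}
    (h : StrictRow (interleave x y)) (k : Fin (2 ^ j)) :
    node x k < ((y k : ℝ) : EReal) ∧ ((y k : ℝ) : EReal) < node x (k + 1) := by
  have hp := pow_succ 2 j
  have h1 := h (2 * k) (by omega)
  have h2 := h (2 * k + 1) (by omega)
  rw [node_interleave_even, node_interleave_odd] at h1
  rw [node_interleave_odd, show 2 * (k : ℕ) + 1 + 1 = 2 * (k + 1) by ring,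
    node_interleave_even] at h2
  exact ⟨h1, h2⟩

theorem StrictRow.left {j : ℕ} {x : Row Θ j} {y : Fin (2 ^ j) → Θ}
    (h : StrictRow (interleave x y)) : StrictRow x := fun l hl =>
  (h.of_interleave ⟨l, hl⟩).1.trans (h.of_interleave ⟨l, hl⟩).2

theorem strictRow_interleave {j : ℕ} {x : Row Θ j} {y : Fin (2 ^ j) → Θ}
    (h : ∀ k : Fin (2 ^ j),
      node x k < ((y k : ℝ) : EReal) ∧ ((y k : ℝ) : EReal) < node x (k + 1)) :
    StrictRow (interleave x y) := by
  intro l hl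
  have hp := pow_succ 2 j
  obtain ⟨k, rfl | rfl⟩ := Nat.even_or_odd' l
  · have := (h ⟨k, by omega⟩).1
    rwa [node_interleave_even, node_interleave_odd x y ⟨k, by omega⟩]
  · have := (h ⟨k, by omega⟩).2
    rwa [show 2 * k + 1 + 1 = 2 * (k + 1) by ring, node_interleave_even,
      node_interleave_odd x y ⟨k, by omega⟩]

theorem measurable_pi_measure {ι X : Type*} [Fintype ι] {Y : ι → Type*} [MeasurableSpace X]
    [∀ i, MeasurableSpace (Y i)] {κ : X → ∀ i, Measure (Y i)} [∀ x i, IsFiniteMeasure (κ x i)]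
    (hκ : ∀ i s, MeasurableSet s → Measurable fun x => κ x i s) :
    Measurable fun x => Measure.pi (κ x) := by
  refine Measurable.measure_of_isPiSystem generateFrom_pi.symm isPiSystem_pi ?_ ?_
  · rintro _ ⟨s, hs, rfl⟩
    simp_rw [Measure.pi_pi]
    exact Finset.measurable_fun_prod _ fun i _ => hκ i _ (hs i trivial)
  · simp_rw [Measure.pi_univ]
    exact Finset.measurable_fun_prod _ fun i _ => hκ i _ MeasurableSet.univ

theorem measurableSet_gap {j : ℕ} (x : Row Θ j) (l : ℕ) : MeasurableSet (gap x l) :=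
  (measurableSet_lt measurable_const continuous_coe_ereal.measurable).inter
    (measurableSet_le continuous_coe_ereal.measurable measurable_const)

theorem measurable_cond_gap {j : ℕ} (μ : Measure Θ) [IsFiniteMeasure μ] (l : ℕ) {s : Set Θ}
    (hs : MeasurableSet s) :
    Measurable fun x : Row Θ j => ProbabilityTheory.cond μ (gap x l) s := by
  have hval : Measurable fun p : Row Θ j × Θ => ((p.2 : ℝ) : EReal) :=
    continuous_coe_ereal.measurable.comp measurable_snd
  have hnode (i : ℕ) : Measurable fun p : Row Θ j × Θ => node p.1 i :=
    (continuous_node i).measurable.comp measurable_fst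
  have hgap : MeasurableSet {p : Row Θ j × Θ | p.2 ∈ gap p.1 l} :=
    (measurableSet_lt (hnode _) hval).inter (measurableSet_le hval (hnode _))
  have h1 : Measurable fun x : Row Θ j => μ (gap x l) := measurable_measure_prodMk_left hgap
  have h2 : Measurable fun x : Row Θ j => μ (gap x l ∩ s) :=
    measurable_measure_prodMk_left (hgap.inter (measurable_snd hs))
  simp_rw [ProbabilityTheory.cond_apply (measurableSet_gap _ _)]
  exact h1.inv.mul h2

/-- The transition from row `j` to row `j + 1` depends measurably on row `j`. -/
theorem measurable_map_interleave {j : ℕ} (μ : Fin (2 ^ j) → Measure Θ)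
    [∀ k, IsFiniteMeasure (μ k)] :
    Measurable fun x : Row Θ j => (Measure.pi fun k : Fin (2 ^ j) =>
      ProbabilityTheory.cond (μ k) (gap x ((k : ℕ) + 1))).map (interleave x) := by
  let κ : Kernel (Row Θ j) (Fin (2 ^ j) → Θ) :=
    ⟨fun x => Measure.pi fun k => ProbabilityTheory.cond (μ k) (gap x ((k : ℕ) + 1)),
      measurable_pi_measure fun k _ hs => measurable_cond_gap (μ k) _ hs⟩
  have : IsFiniteKernel κ := by
    refine ⟨⟨1, ENNReal.one_lt_top, fun x => ?_⟩⟩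
    change Measure.pi _ Set.univ ≤ 1
    rw [Measure.pi_univ]
    exact Finset.prod_le_one' fun k _ => prob_le_one
  refine Measure.measurable_of_measurable_coe _ fun s hs => ?_
  have hc (x : Row Θ j) : Measurable (interleave x) :=
    (continuous_interleave.comp (Continuous.prodMk_right x)).measurable
  simp_rw [Measure.map_apply (hc _) hs]
  exact Kernel.measurable_kernel_prodMk_left (κ := κ) (continuous_interleave.measurable hs)

/-- Openness of the strict order makes the choice uniform: one product of neighbourhoods of the new
points fits into the gaps of every nearby row, so conditioning on those random gaps does not destroy
positivity. -/
theorem exists_mem_nhds_interleave {j : ℕ} {x : Row Θ j} {y : Fin (2 ^ j) → Θ}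
    (h : StrictRow (interleave x y)) {U : Set (Row Θ (j + 1))} (hU : U ∈ 𝓝 (interleave x y)) :
    ∃ A ∈ 𝓝 x, ∃ B : Fin (2 ^ j) → Set Θ, (∀ k, B k ∈ 𝓝 (y k)) ∧
      ∀ x' ∈ A, (∀ k, B k ⊆ gap x' (k + 1)) ∧ Set.pi Set.univ B ⊆ interleave x' ⁻¹' U := by
  have h1 : ∀ᶠ p : Row Θ j × (Fin (2 ^ j) → Θ) in 𝓝 (x, y), interleave p.1 p.2 ∈ U :=
    continuous_interleave.continuousAt.eventually hU
  have h2 (k : Fin (2 ^ j)) : ∀ᶠ p : Row Θ j × Θ in 𝓝 (x, y k),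
      node p.1 k < ((p.2 : ℝ) : EReal) ∧ ((p.2 : ℝ) : EReal) < node p.1 (k + 1) := by
    have hc : Continuous fun p : Row Θ j × Θ => ((p.2 : ℝ) : EReal) :=
      continuous_coe_real_ereal.comp (continuous_subtype_val.comp continuous_snd)
    have hn (l : ℕ) : Continuous fun p : Row Θ j × Θ => node p.1 l :=
      (continuous_node l).comp continuous_fst
    exact ((hn k).continuousAt.eventually_lt hc.continuousAt (h.of_interleave k).1).and
      (hc.continuousAt.eventually_lt (hn (k + 1)).continuousAt (h.of_interleave k).2)
  rw [nhds_prod_eq] at h1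
  simp_rw [nhds_prod_eq] at h2
  obtain ⟨A0, hA0, V, hV, hAV⟩ := mem_prod_iff.1 h1
  choose A hA C hC hAC using fun k => mem_prod_iff.1 (h2 k)
  rw [nhds_pi] at hV
  obtain ⟨I, hI, t, ht, htV⟩ := mem_pi.1 hV
  refine ⟨A0 ∩ ⋂ k, A k, inter_mem hA0 (iInter_mem.2 hA), fun k => t k ∩ C k,
    fun k => inter_mem (ht k) (hC k), fun x' hx' => ⟨fun k s hs => ?_, fun s hs => ?_⟩⟩
  · have := hAC k (Set.mk_mem_prod (Set.mem_iInter.1 hx'.2 k) hs.2)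
    refine ⟨?_, this.2.le⟩
    simpa using this.1
  · exact hAV (Set.mk_mem_prod hx'.1 (htV fun i _ => (hs i (Set.mem_univ i)).1))

theorem cond_pos {X : Type*} [MeasurableSpace X] {μ : Measure X} [IsFiniteMeasure μ]
    {s t : Set X} (ht : MeasurableSet t) (hst : t ⊆ s) (hpos : 0 < μ t) :
    0 < ProbabilityTheory.cond μ s t := by
  rw [ProbabilityTheory.cond, Measure.smul_apply, Measure.restrict_apply ht,
    Set.inter_eq_left.2 hst, smul_eq_mul]
  exact ENNReal.mul_pos (ENNReal.inv_ne_zero.2 (measure_ne_top _ _)) hpos.ne'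

/-- Induction on the level. For all rows close to the old row, the new points fall in a fixed box
with positive conditional probability, and the integral of a positive function over a set of
positive measure is positive. Interiors serve to have measurable sets. -/
theorem rowLaw_pos {H : ℕ → ℕ → Measure Θ} {n : ℕ}
    (hfin : ∀ j l, 1 ≤ j → j ≤ n + 1 → 1 ≤ l → l ≤ 2 ^ (j - 1) →
      IsFiniteMeasure (H j (2 * l - 1)))
    (hsupp : ∀ j l, 1 ≤ j → j ≤ n + 1 → 1 ≤ l → l ≤ 2 ^ (j - 1) →
      (H j (2 * l - 1)).support = Set.univ)
    {j : ℕ} (hj : j ≤ n) {x : Row Θ (j + 1)} (hx : StrictRow x)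
    {U : Set (Row Θ (j + 1))} (hU : U ∈ 𝓝 x) : 0 < rowLaw H j U := by
  induction j with
  | zero =>
    have hm : Continuous fun (t : Θ) (_ : Fin (2 ^ 1 - 1)) => t :=
      continuous_pi fun _ => continuous_id
    let i₀ : Fin (2 ^ (0 + 1) - 1) := ⟨0, by norm_num⟩
    have hxc : (fun _ => x i₀) = x := funext fun i => congrArg x (Fin.ext (by
      have := i.2; norm_num at this; simp [i₀]))
    refine lt_of_lt_of_le ?_ (Measure.le_map_apply hm.measurable.aemeasurable U)
    have h1 : x i₀ ∈ (H 1 1).support := by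
      have := hsupp 1 1 le_rfl (by omega) le_rfl (by simp)
      simp only [mul_one, Nat.reduceSub] at this
      simp [this]
    refine (Measure.mem_support_iff_forall _).1 h1 _ (hm.continuousAt ?_)
    rwa [hxc]
  | succ j ih =>
    have hf (k : Fin (2 ^ (j + 1))) := hfin (j + 2) (k + 1) (by omega) (by omega) (by omega)
      (by simp)
    have hk := (measurable_map_interleave
      fun k : Fin (2 ^ (j + 1)) => H (j + 2) (2 * ((k : ℕ) + 1) - 1)).aemeasurable (μ := rowLaw H j)
    obtain ⟨x, y, rfl⟩ := exists_eq_interleave x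
    obtain ⟨A, hA, B, hB, hAB⟩ := exists_mem_nhds_interleave hx (interior_mem_nhds.2 hU)
    refine lt_of_lt_of_le ?_ (measure_mono interior_subset)
    rw [rowLaw, Measure.bind_apply isOpen_interior.measurableSet hk]
    have hApos := ih (by omega) hx.left (interior_mem_nhds.2 hA)
    refine lt_of_lt_of_le ?_ (setLIntegral_le_lintegral (interior A) _)
    have hx' (x' : Row Θ (j + 1)) (hx' : x' ∈ interior A) : 0 < ((Measure.pi
        fun k : Fin (2 ^ (j + 1)) => ProbabilityTheory.cond (H (j + 2) (2 * ((k : ℕ) + 1) - 1))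
          (gap x' ((k : ℕ) + 1))).map (interleave x')) (interior U) := by
      have hsup (k : Fin (2 ^ (j + 1))) := hsupp (j + 2) (k + 1) (by omega) (by omega) (by omega)
        (by simp)
      have hc : Continuous (interleave x') :=
        continuous_interleave.comp (Continuous.prodMk_right x')
      obtain ⟨h1, h2⟩ := hAB x' (interior_subset hx')
      refine lt_of_lt_of_le ?_ (Measure.le_map_apply hc.measurable.aemeasurable _)
      refine lt_of_lt_of_le ?_ (measure_mono
        ((Set.pi_mono fun k _ => interior_subset (s := B k)).trans h2))
      rw [Measure.pi_pi]
      refine pos_iff_ne_zero.2 (Finset.prod_ne_zero_iff.2 fun k _ => ne_of_gt ?_)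
      refine cond_pos isOpen_interior.measurableSet (interior_subset.trans (h1 k)) ?_
      refine (Measure.mem_support_iff_forall (y k)).1 ?_ _ (interior_mem_nhds.2 (hB k))
      rw [hsup]; trivial
    rw [← setLIntegral_one] at hApos
    by_contra hcon
    rw [not_lt, nonpos_iff_eq_zero, lintegral_eq_zero_iff'] at hcon
    · have := hcon.and (ae_restrict_mem isOpen_interior.measurableSet)
      have hF : ∀ᵐ x' ∂(rowLaw H j).restrict (interior A), False := by
        filter_upwards [this] with a ha
        exact (hx' a ha.2).ne' ha.1
      rw [ae_iff] at hF
      simp only [not_false_eq_true, Set.ofPred_true] at hF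
      rw [setLIntegral_one] at hApos
      simp at hF
      exact hApos.ne' hF
    · exact ((Measure.measurable_coe isOpen_interior.measurableSet).comp_aemeasurable
        hk).restrict

end DSBA

/-! ### Supports of images and products, weak neighbourhoods, the gamma law. -/

namespace MeasureTheory

theorem Measure.mem_support_map {X Y : Type*} [TopologicalSpace X] [MeasurableSpace X]
    [TopologicalSpace Y] [MeasurableSpace Y] {μ : Measure X} {f : X → Y} (hf : AEMeasurable f μ)
    {x : X} (hc : ContinuousAt f x) (hx : x ∈ μ.support) : f x ∈ (μ.map f).support :=
  (Measure.mem_support_iff_forall _).2 fun U hU =>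
    ((Measure.mem_support_iff_forall _).1 hx _ (hc hU)).trans_le (Measure.le_map_apply hf U)

theorem Measure.mk_mem_support_prod {X Y : Type*} [TopologicalSpace X] [MeasurableSpace X]
    [TopologicalSpace Y] [MeasurableSpace Y] {μ : Measure X} {ν : Measure Y} [SFinite ν]
    {x : X} {y : Y} (hx : x ∈ μ.support) (hy : y ∈ ν.support) :
    (x, y) ∈ (μ.prod ν).support := by
  rw [Measure.mem_support_iff_forall] at hx hy ⊢
  intro U hU
  rw [nhds_prod_eq] at hU
  obtain ⟨A, hA, B, hB, hAB⟩ := mem_prod_iff.1 hU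
  refine lt_of_lt_of_le ?_ (measure_mono hAB)
  rw [Measure.prod_prod]
  exact ENNReal.mul_pos (hx A hA).ne' (hy B hB).ne'

theorem Measure.mem_support_pi {ι : Type*} [Fintype ι] {X : ι → Type*}
    [∀ i, TopologicalSpace (X i)] [∀ i, MeasurableSpace (X i)] {μ : ∀ i, Measure (X i)}
    [∀ i, SigmaFinite (μ i)] {x : ∀ i, X i} (hx : ∀ i, x i ∈ (μ i).support) :
    x ∈ (Measure.pi μ).support := by
  simp_rw [Measure.mem_support_iff_forall] at hx ⊢
  intro U hU
  rw [nhds_pi] at hU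
  obtain ⟨I, -, t, ht, htU⟩ := mem_pi.1 hU
  refine lt_of_lt_of_le ?_ (measure_mono ((Set.pi_mono' (fun _ _ => subset_rfl)
    (Set.subset_univ I)).trans htU))
  rw [Measure.pi_pi]
  exact pos_iff_ne_zero.2 (Finset.prod_ne_zero_iff.2 fun i _ => (hx i _ (ht i)).ne')

/-- The weak topology is induced by integration against bounded continuous functions. Finitely many
open conditions on integrals also define a measurable set of measures, which an arbitrary weak
neighbourhood need not be. -/
theorem ProbabilityMeasure.exists_finset_lintegral_nhds {X : Type*} [TopologicalSpace X]
    [MeasurableSpace X] [OpensMeasurableSpace X] {ν : ProbabilityMeasure X}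
    {U : Set (ProbabilityMeasure X)} (hU : U ∈ 𝓝 ν) :
    ∃ (F : Finset (X →ᵇ ℝ≥0)) (O : (X →ᵇ ℝ≥0) → Set ℝ≥0∞),
      (∀ f, O f ∈ 𝓝 (∫⁻ a, f a ∂(ν : Measure X)) ∧ IsOpen (O f)) ∧
      ∀ μ : ProbabilityMeasure X, (∀ f ∈ F, ∫⁻ a, f a ∂(μ : Measure X) ∈ O f) → μ ∈ U := by
  let T : ProbabilityMeasure X → (X →ᵇ ℝ≥0) → ℝ≥0∞ := fun μ f => ∫⁻ a, f a ∂(μ : Measure X)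
  have h : Tendsto id (comap T (𝓝 (T ν))) (𝓝 ν) := by
    rw [ProbabilityMeasure.tendsto_iff_forall_lintegral_tendsto]
    intro f
    exact ((continuous_apply f).continuousAt (x := T ν)).tendsto.comp tendsto_comap
  obtain ⟨V, hV, hVU⟩ := mem_comap.1 (h hU)
  rw [nhds_pi] at hV
  obtain ⟨I, hI, t, ht, htV⟩ := mem_pi.1 hV
  refine ⟨hI.toFinset, fun f => interior (t f),
    fun f => ⟨interior_mem_nhds.2 (ht f), isOpen_interior⟩, fun μ hμ => hVU (htV fun f hf => ?_)⟩
  exact interior_subset (hμ f (hI.mem_toFinset.2 hf))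

end MeasureTheory

/-- The density is positive on intervals just to the right of `x`. The case `x = 0` is needed, since
scale weights of a discretization may vanish. -/
theorem ProbabilityTheory.mem_support_gammaMeasure {a r : ℝ} (ha : 0 < a) (hr : 0 < r) {x : ℝ}
    (hx : 0 ≤ x) : x ∈ (gammaMeasure a r).support := by
  rw [Measure.mem_support_iff_forall]
  intro U hU
  obtain ⟨δ, hδ, hball⟩ := Metric.mem_nhds_iff.1 hU
  have hsub : Set.Ioo x (x + δ) ⊆ U := fun y hy => hball (by
    rw [Metric.mem_ball, Real.dist_eq, abs_lt]; constructor <;> linarith [hy.1, hy.2])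
  refine lt_of_lt_of_le ?_ (measure_mono hsub)
  have hm : Measurable (gammaPDF a r) := (measurable_gammaPDFReal a r).ennreal_ofReal
  rw [gammaMeasure, withDensity_apply _ measurableSet_Ioo, setLIntegral_pos_iff hm]
  have : Set.Ioo x (x + δ) ⊆ Function.support (gammaPDF a r) ∩ Set.Ioo x (x + δ) := fun y hy =>
    ⟨(ENNReal.ofReal_pos.2 (gammaPDFReal_pos ha hr (hx.trans_lt hy.1))).ne', hy⟩
  refine lt_of_lt_of_le ?_ (measure_mono this)
  simp [hδ]

/-! ### Discretizations coming from strict rows are charged by the conditional law. -/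

namespace DSBA

variable {Θ : Set ℝ}

/-- A point of the simplex, boundary included, is a possible gamma vector; its coordinates sum to
`1`, so normalization fixes it and is continuous there. -/
theorem mem_support_dirichletMeasure {m : ℕ} {α : Fin m → ℝ} (hα : ∀ i, 0 < α i) {w : Fin m → ℝ}
    (hw : w ∈ stdSimplex ℝ (Fin m)) : w ∈ (dirichletMeasure α).support := by
  have (i : Fin m) := isProbabilityMeasure_gammaMeasure (hα i) one_pos
  have h := Measure.mem_support_map (f := fun (g : Fin m → ℝ) i => g i / ∑ k, g k)
    (μ := Measure.pi fun i => gammaMeasure (α i) 1) (x := w) (Measurable.aemeasurable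
      (by fun_prop)) ?_
    (Measure.mem_support_pi fun i => mem_support_gammaMeasure (hα i) one_pos (hw.1 i))
  · simp only [hw.2, div_one] at h
    exact h
  · refine continuousAt_pi.2 fun i => ContinuousAt.div (continuous_apply i).continuousAt
      (Continuous.continuousAt (by fun_prop)) ?_
    simp [hw.2]

instance isProbabilityMeasure_dirichletMeasure {m : ℕ} {α : Fin m → ℝ} [Fact (∀ i, 0 < α i)] :
    IsProbabilityMeasure (dirichletMeasure α) := by
  have (i : Fin m) := isProbabilityMeasure_gammaMeasure (Fact.out (p := ∀ i, 0 < α i) i) one_pos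
  exact Measure.isProbabilityMeasure_map (Measurable.aemeasurable (by fun_prop))

theorem mem_support_rowLaw {H : ℕ → ℕ → Measure Θ} {n : ℕ}
    (hfin : ∀ j l, 1 ≤ j → j ≤ n + 1 → 1 ≤ l → l ≤ 2 ^ (j - 1) →
      IsFiniteMeasure (H j (2 * l - 1)))
    (hsupp : ∀ j l, 1 ≤ j → j ≤ n + 1 → 1 ≤ l → l ≤ 2 ^ (j - 1) →
      (H j (2 * l - 1)).support = Set.univ)
    {x : Row Θ (n + 1)} (hx : StrictRow x) :
    x ∈ (rowLaw H n).support :=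
  (Measure.mem_support_iff_forall _).2 fun _ hU => rowLaw_pos hfin hsupp le_rfl hx hU

theorem continuous_bary {n : ℕ} (j l : ℕ) : Continuous fun x : Row Θ (n + 1) => bary x j l := by
  unfold bary node
  split_ifs
  · exact continuous_subtype_val.comp (continuous_apply _)
  · exact continuous_const
  · exact continuous_const

theorem measurable_cdfAt_bary {n : ℕ} (j i : ℕ) :
    Measurable fun x : Row Θ (n + 1) => cdfAt (bary x) j i := by
  have hb (j l : ℕ) : Measurable fun x : Row Θ (n + 1) => bary x j l :=
    (continuous_bary j l).measurable
  induction j generalizing i with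
  | zero => simp only [cdfAt]; exact measurable_const
  | succ j ih =>
    simp only [cdfAt]
    split_ifs
    · exact ih _
    · refine (ih _).add (((ih _).sub (ih _)).mul ?_)
      unfold divOne
      refine Measurable.ite (MeasurableSet.inter ?_ ?_) measurable_const
        (((hb _ _).sub (hb _ _)).div ((hb _ _).sub (hb _ _)))
      · exact ((hb _ _).sub (hb _ _)) (measurableSet_singleton 0)
      · exact ((hb _ _).sub (hb _ _)) (measurableSet_singleton 0)

theorem measurable_discreteMeasure {n m : ℕ} :
    Measurable fun p : Row Θ (n + 1) × (Fin m → ℝ≥0) × (Fin (2 ^ n) → Fin m → ℝ) =>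
      discreteMeasure p.1 p.2.1 p.2.2 := by
  refine Measure.measurable_of_measurable_coe _ fun s hs => ?_
  simp only [discreteMeasure, Measure.finsetSum_apply, Measure.smul_apply, smul_eq_mul]
  refine Finset.measurable_fun_sum _ fun k _ => Finset.measurable_fun_sum _ fun i _ => ?_
  refine Measurable.mul (Measurable.ennreal_ofReal (Measurable.mul ?_ (by fun_prop))) ?_
  · exact ((measurable_cdfAt_bary _ _).sub (measurable_cdfAt_bary _ _)).comp measurable_fst
  · refine (Measure.measurable_coe hs).comp (Measure.measurable_dirac.comp ?_)
    unfold locAtom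
    fun_prop

theorem StrictRow.node_lt {j : ℕ} {x : Row Θ j} (hx : StrictRow x) {a b : ℕ} (hab : a < b)
    (hb : b ≤ 2 ^ j) : node x a < node x b := by
  induction b, hab using Nat.le_induction with
  | base => exact hx a (by omega)
  | succ b _ ih => exact (ih (by omega)).trans (hx b (by omega))

/-- Only interior indices are allowed: the end nodes may be infinite, and `toReal` would send them
to `0`. -/
theorem StrictRow.bary_lt {n : ℕ} {x : Row Θ (n + 1)} (hx : StrictRow x) {j a b : ℕ}
    (hj : j ≤ n + 1) (ha : 1 ≤ a) (hab : a < b) (hb : b < 2 ^ j) : bary x j a < bary x j b := by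
  have hp : 0 < 2 ^ (n + 1 - j) := by positivity
  have hmul : 2 ^ (n + 1 - j) * 2 ^ j = 2 ^ (n + 1) := by
    rw [← pow_add]; congr 1; omega
  have h1 : 2 ^ (n + 1 - j) * b < 2 ^ (n + 1) := by rw [← hmul]; gcongr
  have h2 : 2 ^ (n + 1 - j) * a < 2 ^ (n + 1 - j) * b := by gcongr
  have h3 : 1 ≤ 2 ^ (n + 1 - j) * a := Nat.mul_pos hp ha
  have := hx.node_lt h2 h1.le
  rw [node_of_mem x h3 (h2.trans h1), node_of_mem x (h3.trans h2.le) h1,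
    EReal.coe_lt_coe_iff] at this
  rwa [bary, bary, node_of_mem x h3 (h2.trans h1), node_of_mem x (h3.trans h2.le) h1]

theorem continuousAt_divOne {X : Type*} [TopologicalSpace X] {f g : X → ℝ} {x : X}
    (hf : ContinuousAt f x) (hg : ContinuousAt g x) (h : g x ≠ 0) :
    ContinuousAt (fun y => divOne (f y) (g y)) x := by
  refine (hf.div hg h).congr ?_
  filter_upwards [hg.eventually_ne h] with y hy
  simp [divOne, hy]

/-- The denominators are differences of distinct interior nodes, with indices `4l - 3 ≥ 1` and `4l -
1 < 2 ^ (j + 2)`, so the convention for `0 / 0` plays no role near a strict row. -/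
theorem StrictRow.continuousAt_cdfAt {n : ℕ} {x : Row Θ (n + 1)} (hx : StrictRow x) {j i : ℕ}
    (hj : j ≤ n) (hi : i ≤ 2 ^ j) : ContinuousAt (fun y => cdfAt (bary y) j i) x := by
  induction j generalizing i with
  | zero => simp only [cdfAt]; exact continuousAt_const
  | succ j ih =>
    have hp := pow_succ 2 j
    have hp' := pow_succ 2 (j + 1)
    simp only [cdfAt]
    split_ifs
    · exact ih (by omega) (by omega)
    · refine (ih (by omega) (by omega)).add (((ih (by omega) (by omega)).sub
        (ih (by omega) (by omega))).mul (continuousAt_divOne ?_ ?_ ?_))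
      · exact ((continuous_bary _ _).sub (continuous_bary _ _)).continuousAt
      · exact ((continuous_bary _ _).sub (continuous_bary _ _)).continuousAt
      · exact sub_ne_zero.2 (hx.bary_lt (by omega) (by omega) (by omega)
          (by rw [show j + 2 = j + 1 + 1 from rfl]; omega)).ne'

theorem StrictRow.continuousAt_locWeight {n : ℕ} {x : Row Θ (n + 1)} (hx : StrictRow x) {l : ℕ}
    (hl : l ≤ 2 ^ n) : ContinuousAt (fun y => locWeight y l) x :=
  (hx.continuousAt_cdfAt le_rfl hl).sub (hx.continuousAt_cdfAt le_rfl (by omega))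

theorem lintegral_discreteMeasure {n m : ℕ} (x : Row Θ (n + 1)) (φ : Fin m → ℝ≥0)
    (w : Fin (2 ^ n) → Fin m → ℝ) (f : Θ × ℝ≥0 →ᵇ ℝ≥0) :
    ∫⁻ a, f a ∂(discreteMeasure x φ w) = ∑ k₁ : Fin (2 ^ n), ∑ k₂ : Fin m,
      ((Real.toNNReal (locWeight x ((k₁ : ℕ) + 1) * w k₁ k₂) * f (locAtom x k₁, φ k₂) : ℝ≥0) :
        ℝ≥0∞) := by
  simp_rw [discreteMeasure, lintegral_finsetSum_measure, lintegral_smul_measure]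
  refine Finset.sum_congr rfl fun i _ => Finset.sum_congr rfl fun j _ => ?_
  rw [lintegral_dirac' _ (by fun_prop), ENNReal.coe_mul]
  rfl

theorem StrictRow.continuousAt_lintegral_discreteMeasure {n m : ℕ} {x : Row Θ (n + 1)}
    (hx : StrictRow x) (φ : Fin m → ℝ≥0) (w : Fin (2 ^ n) → Fin m → ℝ) (f : Θ × ℝ≥0 →ᵇ ℝ≥0) :
    ContinuousAt (fun p : Row Θ (n + 1) × (Fin m → ℝ≥0) × (Fin (2 ^ n) → Fin m → ℝ) =>
      ∫⁻ a, f a ∂(discreteMeasure p.1 p.2.1 p.2.2)) (x, φ, w) := by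
  simp_rw [lintegral_discreteMeasure]
  refine tendsto_finsetSum _ fun i _ => tendsto_finsetSum _ fun j _ => ?_
  refine ENNReal.continuous_coe.continuousAt.tendsto.comp (Tendsto.mul ?_ ?_)
  · refine continuous_real_toNNReal.continuousAt.tendsto.comp (Tendsto.mul ?_ ?_)
    · exact (hx.continuousAt_locWeight (by omega)).tendsto.comp
        continuous_fst.continuousAt.tendsto
    · exact Continuous.tendsto' (by fun_prop) _ _ rfl
  · refine Continuous.tendsto' ?_ _ _ rfl
    unfold locAtom
    fun_prop

theorem exists_measurableSet_dsbasgLaw_pos {n m : ℕ} {H : ℕ → ℕ → Measure Θ}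
    (hfin : ∀ j l, 1 ≤ j → j ≤ n + 1 → 1 ≤ l → l ≤ 2 ^ (j - 1) →
      IsFiniteMeasure (H j (2 * l - 1)))
    (hsupp : ∀ j l, 1 ≤ j → j ≤ n + 1 → 1 ≤ l → l ≤ 2 ^ (j - 1) →
      (H j (2 * l - 1)).support = Set.univ)
    {Pη : Measure ℝ≥0} [IsProbabilityMeasure Pη] (hPη : Pη.support = Set.univ)
    {α : Fin m → ℝ} (hα : ∀ i, 0 < α i)
    {x : Row Θ (n + 1)} (hx : StrictRow x) (φ : Fin m → ℝ≥0) {w : Fin (2 ^ n) → Fin m → ℝ}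
    (hw : ∀ k, w k ∈ stdSimplex ℝ (Fin m)) {ν : ProbabilityMeasure (Θ × ℝ≥0)}
    (hν : (ν : Measure (Θ × ℝ≥0)) = discreteMeasure x φ w)
    {U : Set (ProbabilityMeasure (Θ × ℝ≥0))} (hU : U ∈ 𝓝 ν) :
    ∃ S : Set (Measure (Θ × ℝ≥0)), MeasurableSet S ∧ 0 < dsbasgLaw n H Pη m α S ∧
      ∀ μ : ProbabilityMeasure (Θ × ℝ≥0), (μ : Measure (Θ × ℝ≥0)) ∈ S → μ ∈ U := by
  have : Fact (∀ i, 0 < α i) := ⟨hα⟩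
  obtain ⟨F, O, hO, hFU⟩ := ProbabilityMeasure.exists_finset_lintegral_nhds hU
  refine ⟨{μ | ∀ f ∈ F, ∫⁻ a, f a ∂μ ∈ O f}, ?_, ?_, fun μ hμ => hFU μ hμ⟩
  · have : {μ : Measure (Θ × ℝ≥0) | ∀ f ∈ F, ∫⁻ a, f a ∂μ ∈ O f} =
        ⋂ f ∈ F, (fun μ : Measure (Θ × ℝ≥0) => ∫⁻ a, f a ∂μ) ⁻¹' O f := by ext; simp
    rw [this]
    refine Finset.measurableSet_biInter _ fun f _ => ?_
    exact Measure.measurable_lintegral (by fun_prop) (hO f).2.measurableSet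
  · refine lt_of_lt_of_le ?_ (Measure.le_map_apply
      measurable_discreteMeasure.aemeasurable _)
    have hmem := Measure.mk_mem_support_prod (mem_support_rowLaw hfin hsupp hx)
      (Measure.mk_mem_support_prod
        (Measure.mem_support_pi (μ := fun _ : Fin m => Pη) (x := φ) fun i => by simp [hPη])
        (Measure.mem_support_pi (μ := fun _ : Fin (2 ^ n) => dirichletMeasure α) (x := w)
          fun k => mem_support_dirichletMeasure hα (hw k)))
    refine (Measure.mem_support_iff_forall _).1 hmem _ ?_
    have : ∀ᶠ p : Row Θ (n + 1) × (Fin m → ℝ≥0) × (Fin (2 ^ n) → Fin m → ℝ) in 𝓝 (x, φ, w),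
        ∀ f ∈ F, ∫⁻ a, f a ∂(discreteMeasure p.1 p.2.1 p.2.2) ∈ O f := by
      rw [Filter.eventually_all_finset]
      intro f _
      refine (hx.continuousAt_lintegral_discreteMeasure φ w f).eventually ?_
      have := (hO f).1
      rwa [hν] at this
    exact this

end DSBA

/-! ### The sequential barycenter array of a regular measure and its inversion. -/

namespace DSBA

variable {Θ : Set ℝ}

theorem sInf_le_node {j : ℕ} (x : Row Θ j) (l : ℕ) (hne : Θ.Nonempty) :
    sInf ((fun t : ℝ => (t : EReal)) '' Θ) ≤ node x l := by
  unfold node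
  split_ifs
  · exact sInf_le ⟨_, Subtype.coe_prop _, rfl⟩
  · exact le_rfl
  · exact sInf_le_sSup (hne.image _)

theorem node_le_sSup {j : ℕ} (x : Row Θ j) (l : ℕ) (hne : Θ.Nonempty) :
    node x l ≤ sSup ((fun t : ℝ => (t : EReal)) '' Θ) := by
  unfold node
  split_ifs
  · exact le_sSup ⟨_, Subtype.coe_prop _, rfl⟩
  · exact sInf_le_sSup (hne.image _)
  · exact le_rfl

theorem exists_mem_between (hΘ : Θ.OrdConnected) {a b : EReal} (hab : a < b)
    (ha : sInf ((fun t : ℝ => (t : EReal)) '' Θ) ≤ a)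
    (hb : b ≤ sSup ((fun t : ℝ => (t : EReal)) '' Θ)) :
    ∃ t : Θ, a < ((t : ℝ) : EReal) ∧ ((t : ℝ) : EReal) < b := by
  obtain ⟨_, ⟨u, hu, rfl⟩, hau⟩ := lt_sSup_iff.1 (hab.trans_le hb)
  obtain ⟨_, ⟨v, hv, rfl⟩, hvb⟩ := sInf_lt_iff.1 (ha.trans_lt hab)
  by_cases h1 : (u : EReal) < b
  · exact ⟨⟨u, hu⟩, hau, h1⟩
  by_cases h2 : a < (v : EReal)
  · exact ⟨⟨v, hv⟩, h2, hvb⟩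
  -- Now `v ≤ a < b ≤ u`, so any real number between `a` and `b` lies between two points of `Θ`.
  obtain ⟨q, hq1, hq2⟩ := EReal.lt_iff_exists_real_btwn.1 hab
  refine ⟨⟨q, hΘ.out hv hu ⟨?_, ?_⟩⟩, hq1, hq2⟩
  · exact EReal.coe_le_coe_iff.1 ((not_lt.1 h2).trans hq1.le)
  · exact EReal.coe_le_coe_iff.1 (hq2.le.trans (not_lt.1 h1))

/-- The mean of a measure `μ` on `Θ` over the set `s`. -/
noncomputable def baryPt [Nonempty Θ] (μ : Measure Θ) (s : Set Θ) : Θ :=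
  open Classical in
  if h : (⨍ t in s, (t : ℝ) ∂μ) ∈ Θ then ⟨_, h⟩ else Classical.arbitrary Θ

/-- The sequential barycenter array of a measure `μ` on `Θ`. -/
noncomputable def sbaRow [Nonempty Θ] (μ : Measure Θ) : (j : ℕ) → Row Θ j
  | 0 => fun _ => Classical.arbitrary Θ
  | j + 1 => interleave (sbaRow μ j) fun k => baryPt μ (gap (sbaRow μ j) (k + 1))

/-- The barycenter of `μ` over the `k`-th interval (counted from `0`) of row `j`. -/
noncomputable def sbaPt [Nonempty Θ] (μ : Measure Θ) (j k : ℕ) : Θ :=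
  baryPt μ (gap (sbaRow μ j) (k + 1))

/-- Probability measures on `Θ` that have full support, a finite second moment and no mass at the
left endpoint of `Θ`. -/
structure IsRegular (μ : Measure Θ) : Prop where
  prob : IsProbabilityMeasure μ
  openPos : μ.IsOpenPosMeasure
  memLp : MemLp (fun t : Θ => (t : ℝ)) 2 μ
  left : μ {t : Θ | ((t : ℝ) : EReal) ≤ sInf ((fun t : ℝ => (t : EReal)) '' Θ)} = 0

variable {μ : Measure Θ}

theorem IsRegular.integrable (hμ : IsRegular μ) : Integrable (fun t : Θ => (t : ℝ)) μ :=
  have := hμ.prob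
  hμ.memLp.integrable one_le_two

theorem IsRegular.integrable_sq (hμ : IsRegular μ) (c : ℝ) :
    Integrable (fun t : Θ => ((t : ℝ) - c) ^ 2) μ :=
  have := hμ.prob
  (hμ.memLp.sub (memLp_const c)).integrable_sq

theorem IsRegular.integrable_abs (hμ : IsRegular μ) (c : ℝ) :
    Integrable (fun t : Θ => |(t : ℝ) - c|) μ :=
  have := hμ.prob
  (hμ.integrable.sub (integrable_const c)).abs

theorem setIntegral_sub_const [IsFiniteMeasure μ]
    (hi : Integrable (fun t : Θ => (t : ℝ)) μ) (s : Set Θ) (c : ℝ) :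
    ∫ t in s, ((t : ℝ) - c) ∂μ = (∫ t in s, (t : ℝ) ∂μ) - μ.real s * c := by
  rw [integral_sub hi.integrableOn (integrable_const _)]
  simp

theorem measure_between_pos (hΘ : Θ.OrdConnected) [μ.IsOpenPosMeasure] {a b : EReal} (hab : a < b)
    (ha : sInf ((fun t : ℝ => (t : EReal)) '' Θ) ≤ a)
    (hb : b ≤ sSup ((fun t : ℝ => (t : EReal)) '' Θ)) :
    0 < μ {t : Θ | a < ((t : ℝ) : EReal) ∧ ((t : ℝ) : EReal) < b} :=
  ((isOpen_lt continuous_const continuous_coe_ereal).inter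
    (isOpen_lt continuous_coe_ereal continuous_const)).measure_pos μ
      (exists_mem_between hΘ hab ha hb)

variable [Nonempty Θ]

theorem val_baryPt (hΘc : IsClosed Θ) (hΘ : Θ.OrdConnected) [IsFiniteMeasure μ]
    (hi : Integrable (fun t : Θ => (t : ℝ)) μ) {s : Set Θ} (hs : μ s ≠ 0) :
    (baryPt μ s : ℝ) = ⨍ t in s, (t : ℝ) ∂μ := by
  have : (⨍ t in s, (t : ℝ) ∂μ) ∈ Θ := hΘ.convex.set_average_mem hΘc hs (measure_ne_top _ _)
    (ae_of_all _ fun t => t.2) hi.integrableOn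
  rw [baryPt, dif_pos this]

theorem setIntegral_eq_mul_baryPt (hΘc : IsClosed Θ) (hΘ : Θ.OrdConnected) [IsFiniteMeasure μ]
    (hi : Integrable (fun t : Θ => (t : ℝ)) μ) {s : Set Θ} (hs : μ s ≠ 0) :
    ∫ t in s, (t : ℝ) ∂μ = μ.real s * baryPt μ s := by
  have h0 : μ.real s ≠ 0 := (measureReal_ne_zero_iff (measure_ne_top _ _)).2 hs
  rw [val_baryPt hΘc hΘ hi hs, setAverage_eq, smul_eq_mul, mul_inv_cancel_left₀ h0]

/-- The deviation from the mean integrates to zero, so it cannot have a strict sign on a set of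
positive mass. At the right end, where an atom at `b` is possible, full support supplies mass in the
open interval. -/
theorem baryPt_between (hΘc : IsClosed Θ) (hΘ : Θ.OrdConnected) (hμ : IsRegular μ)
    {a b : EReal} (hab : a < b) (ha : sInf ((fun t : ℝ => (t : EReal)) '' Θ) ≤ a)
    (hb : b ≤ sSup ((fun t : ℝ => (t : EReal)) '' Θ)) :
    a < ((baryPt μ {t : Θ | a < ((t : ℝ) : EReal) ∧ ((t : ℝ) : EReal) ≤ b} : ℝ) : EReal) ∧
    ((baryPt μ {t : Θ | a < ((t : ℝ) : EReal) ∧ ((t : ℝ) : EReal) ≤ b} : ℝ) : EReal) < b := by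
  have := hμ.prob
  have := hμ.openPos
  have hi : Integrable (fun t : Θ => (t : ℝ)) μ := hμ.memLp.integrable one_le_two
  set s := {t : Θ | a < ((t : ℝ) : EReal) ∧ ((t : ℝ) : EReal) ≤ b} with hs
  have hpos := measure_between_pos (μ := μ) hΘ hab ha hb
  have hms : MeasurableSet s :=
    (measurableSet_lt measurable_const continuous_coe_ereal.measurable).inter
      (measurableSet_le continuous_coe_ereal.measurable measurable_const)
  have hsub : {t : Θ | a < ((t : ℝ) : EReal) ∧ ((t : ℝ) : EReal) < b} ⊆ s :=
    fun t ht => ⟨ht.1, ht.2.le⟩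
  have hspos : μ s ≠ 0 := (hpos.trans_le (measure_mono hsub)).ne'
  have hzero : ∫ t in s, ((t : ℝ) - baryPt μ s) ∂μ = 0 := by
    rw [setIntegral_sub_const hi, setIntegral_eq_mul_baryPt hΘc hΘ hi hspos, sub_self]
  have hint : IntegrableOn (fun t : Θ => (t : ℝ) - baryPt μ s) s μ :=
    hi.integrableOn.sub (integrable_const _)
  constructor
  · by_contra hcon
    have hlt (t : Θ) (ht : t ∈ s) : 0 < (t : ℝ) - baryPt μ s :=
      sub_pos.2 (EReal.coe_lt_coe_iff.1 ((not_lt.1 hcon).trans_lt ht.1))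
    have hae := (setIntegral_eq_zero_iff_of_nonneg_ae
      ((ae_restrict_mem hms).mono fun t ht => (hlt t ht).le) hint).1 hzero
    refine hspos (measure_eq_zero_iff_ae_notMem.2 ?_)
    filter_upwards [(ae_restrict_iff' hms).1 hae] with t ht hts
    exact (hlt t hts).ne' (ht hts)
  · by_contra hcon
    have hle (t : Θ) (ht : t ∈ s) : 0 ≤ -((t : ℝ) - baryPt μ s) := by
      have := EReal.coe_le_coe_iff.1 (ht.2.trans (not_lt.1 hcon))
      linarith
    have hae := (setIntegral_eq_zero_iff_of_nonneg_ae
      ((ae_restrict_mem hms).mono fun t ht => hle t ht) hint.neg).1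
      (by simp only [integral_neg, hzero, neg_zero])
    refine hpos.ne' (measure_eq_zero_iff_ae_notMem.2 ?_)
    filter_upwards [(ae_restrict_iff' hms).1 hae] with t ht hts
    have h1 := ht (hsub hts)
    have h2 := EReal.coe_lt_coe_iff.1 (hts.2.trans_le (not_lt.1 hcon))
    simp only [Pi.zero_apply] at h1
    linarith

theorem strictRow_sbaRow (hΘc : IsClosed Θ) (hΘ : Θ.OrdConnected) (hnt : Θ.Nontrivial)
    (hμ : IsRegular μ) (j : ℕ) : StrictRow (sbaRow μ j) := by
  induction j with
  | zero =>
    intro l hl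
    obtain rfl : l = 0 := by simpa using hl
    rw [node_zero]
    have := node_top (sbaRow μ 0)
    rw [pow_zero] at this
    rw [zero_add, this]
    obtain ⟨a, ha, b, hb, hab⟩ := hnt.exists_lt
    exact (sInf_le (Set.mem_image_of_mem _ ha)).trans_lt
      ((EReal.coe_lt_coe_iff.2 hab).trans_le (le_sSup (Set.mem_image_of_mem _ hb)))
  | succ j ih =>
    refine strictRow_interleave fun k => ?_
    exact baryPt_between hΘc hΘ hμ (ih k k.2) (sInf_le_node _ _ hnt.nonempty)
      (node_le_sSup _ _ hnt.nonempty)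

theorem node_sbaRow_even (j k : ℕ) : node (sbaRow μ (j + 1)) (2 * k) = node (sbaRow μ j) k :=
  node_interleave_even _ _ _

theorem node_sbaRow_odd {j k : ℕ} (hk : k < 2 ^ j) :
    node (sbaRow μ (j + 1)) (2 * k + 1) = ((sbaPt μ j k : ℝ) : EReal) :=
  node_interleave_odd _ _ ⟨k, hk⟩

theorem sbaPt_between (hΘc : IsClosed Θ) (hΘ : Θ.OrdConnected) (hnt : Θ.Nontrivial)
    (hμ : IsRegular μ) {j k : ℕ} (hk : k < 2 ^ j) :
    node (sbaRow μ j) k < ((sbaPt μ j k : ℝ) : EReal) ∧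
      ((sbaPt μ j k : ℝ) : EReal) < node (sbaRow μ j) (k + 1) :=
  (strictRow_sbaRow hΘc hΘ hnt hμ (j + 1)).of_interleave ⟨k, hk⟩

theorem gap_sbaRow_left (hΘc : IsClosed Θ) (hΘ : Θ.OrdConnected) (hnt : Θ.Nontrivial)
    (hμ : IsRegular μ) {j k : ℕ} (hk : k < 2 ^ j) :
    gap (sbaRow μ (j + 1)) (2 * k + 1) = gap (sbaRow μ j) (k + 1) ∩ Set.Iic (sbaPt μ j k) := by
  ext t
  have := (sbaPt_between hΘc hΘ hnt hμ hk).2.le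
  simp only [gap, Set.mem_ofPred_eq, Set.mem_inter_iff, Set.mem_Iic, Nat.add_sub_cancel, node_sbaRow_even,
    node_sbaRow_odd hk, EReal.coe_le_coe_iff, Subtype.coe_le_coe]
  refine ⟨fun h => ⟨⟨h.1, le_trans ?_ this⟩, h.2⟩, fun h => ⟨h.1.1, h.2⟩⟩
  exact EReal.coe_le_coe_iff.2 h.2

theorem gap_sbaRow_right (hΘc : IsClosed Θ) (hΘ : Θ.OrdConnected) (hnt : Θ.Nontrivial)
    (hμ : IsRegular μ) {j k : ℕ} (hk : k < 2 ^ j) :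
    gap (sbaRow μ (j + 1)) (2 * k + 1 + 1) =
      gap (sbaRow μ j) (k + 1) ∩ (Set.Iic (sbaPt μ j k))ᶜ := by
  ext t
  have := (sbaPt_between hΘc hΘ hnt hμ hk).1
  simp only [gap, Set.mem_ofPred_eq, Set.mem_inter_iff, Set.mem_Iic, Nat.add_sub_cancel,
    show 2 * k + 1 + 1 = 2 * (k + 1) by ring, node_sbaRow_even,
    show 2 * (k + 1) - 1 = 2 * k + 1 by omega, node_sbaRow_odd hk, EReal.coe_lt_coe_iff,
    Set.mem_compl_iff, not_le, Subtype.coe_lt_coe]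
  refine ⟨fun h => ⟨⟨this.trans ?_, h.2⟩, h.1⟩, fun h => ⟨h.2, h.1.2⟩⟩
  exact EReal.coe_lt_coe_iff.2 h.1

theorem measure_gap_sbaRow_ne_zero (hΘc : IsClosed Θ) (hΘ : Θ.OrdConnected) (hnt : Θ.Nontrivial)
    (hμ : IsRegular μ) {j k : ℕ} (hk : k < 2 ^ j) : μ (gap (sbaRow μ j) (k + 1)) ≠ 0 := by
  have := hμ.openPos
  refine ((measure_between_pos (μ := μ) hΘ (strictRow_sbaRow hΘc hΘ hnt hμ j k hk)
    (sInf_le_node _ _ hnt.nonempty) (node_le_sSup _ _ hnt.nonempty)).trans_le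
      (measure_mono ?_)).ne'
  exact fun t ht => ⟨ht.1, ht.2.le⟩

theorem measureReal_gap (hΘc : IsClosed Θ) (hΘ : Θ.OrdConnected) (hnt : Θ.Nontrivial)
    (hμ : IsRegular μ) {j k : ℕ} (hk : k < 2 ^ j) : μ.real (gap (sbaRow μ j) (k + 1)) =
      μ.real {t : Θ | ((t : ℝ) : EReal) ≤ node (sbaRow μ j) (k + 1)} -
      μ.real {t : Θ | ((t : ℝ) : EReal) ≤ node (sbaRow μ j) k} := by
  have := hμ.prob
  have hlt := strictRow_sbaRow hΘc hΘ hnt hμ j k hk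
  have hsub : {t : Θ | ((t : ℝ) : EReal) ≤ node (sbaRow μ j) k} ⊆
      {t : Θ | ((t : ℝ) : EReal) ≤ node (sbaRow μ j) (k + 1)} := fun t ht => le_trans ht hlt.le
  rw [← measureReal_sdiff hsub
    (measurableSet_le continuous_coe_ereal.measurable measurable_const)]
  congr 1
  ext t
  simp [gap, and_comm]

theorem setIntegral_gap (hΘc : IsClosed Θ) (hΘ : Θ.OrdConnected) (hnt : Θ.Nontrivial)
    (hμ : IsRegular μ) {j k : ℕ} (hk : k < 2 ^ j) :
    ∫ t in gap (sbaRow μ j) (k + 1), (t : ℝ) ∂μ =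
      μ.real (gap (sbaRow μ j) (k + 1)) * sbaPt μ j k :=
  have := hμ.prob
  setIntegral_eq_mul_baryPt hΘc hΘ (hμ.memLp.integrable one_le_two)
    (measure_gap_sbaRow_ne_zero hΘc hΘ hnt hμ hk)

theorem measureReal_gap_split (hΘc : IsClosed Θ) (hΘ : Θ.OrdConnected) (hnt : Θ.Nontrivial)
    (hμ : IsRegular μ) {j k : ℕ} (hk : k < 2 ^ j) : μ.real (gap (sbaRow μ j) (k + 1)) =
      μ.real (gap (sbaRow μ (j + 1)) (2 * k + 1)) +
      μ.real (gap (sbaRow μ (j + 1)) (2 * k + 1 + 1)) := by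
  have := hμ.prob
  rw [gap_sbaRow_left hΘc hΘ hnt hμ hk, gap_sbaRow_right hΘc hΘ hnt hμ hk, ← Set.sdiff_eq,
    measureReal_inter_add_sdiff measurableSet_Iic]

theorem setIntegral_gap_split (hΘc : IsClosed Θ) (hΘ : Θ.OrdConnected) (hnt : Θ.Nontrivial)
    (hμ : IsRegular μ) {j k : ℕ} (hk : k < 2 ^ j) {f : Θ → ℝ} (hf : Integrable f μ) :
    ∫ t in gap (sbaRow μ j) (k + 1), f t ∂μ =
      ∫ t in gap (sbaRow μ (j + 1)) (2 * k + 1), f t ∂μ +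
      ∫ t in gap (sbaRow μ (j + 1)) (2 * k + 1 + 1), f t ∂μ := by
  rw [gap_sbaRow_left hΘc hΘ hnt hμ hk, gap_sbaRow_right hΘc hΘ hnt hμ hk, ← Set.sdiff_eq,
    integral_inter_add_sdiff measurableSet_Iic hf.integrableOn]

/-- The first moment of a gap is computed from its own barycenter and from those of its two halves;
the lever rule results. -/
theorem barycenter_balance (hΘc : IsClosed Θ) (hΘ : Θ.OrdConnected) (hnt : Θ.Nontrivial)
    (hμ : IsRegular μ) {j k : ℕ} (hk : k < 2 ^ j) :
    μ.real (gap (sbaRow μ (j + 1)) (2 * k + 1)) * (sbaPt μ j k - sbaPt μ (j + 1) (2 * k)) =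
      μ.real (gap (sbaRow μ (j + 1)) (2 * k + 1 + 1)) *
        (sbaPt μ (j + 1) (2 * k + 1) - sbaPt μ j k) := by
  have hp := pow_succ 2 j
  have := hμ.prob
  have h1 := setIntegral_gap_split hΘc hΘ hnt hμ hk (hμ.memLp.integrable one_le_two)
  rw [setIntegral_gap hΘc hΘ hnt hμ hk, setIntegral_gap hΘc hΘ hnt hμ (by omega),
    setIntegral_gap hΘc hΘ hnt hμ (by omega), measureReal_gap_split hΘc hΘ hnt hμ hk] at h1
  linarith

theorem node_sbaRow_add (j i l : ℕ) :
    node (sbaRow μ (j + i)) (2 ^ i * l) = node (sbaRow μ j) l := by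
  induction i with
  | zero => simp
  | succ i ih => rw [pow_succ', mul_assoc, ← add_assoc, node_sbaRow_even, ih]

theorem bary_sbaRow {n j : ℕ} (hj : j ≤ n + 1) (l : ℕ) :
    bary (sbaRow μ (n + 1)) j l = (node (sbaRow μ j) l).toReal := by
  obtain ⟨i, hi⟩ := Nat.exists_eq_add_of_le hj
  rw [bary, ← node_sbaRow_add j i l, hi, Nat.add_sub_cancel_left]

theorem bary_sbaRow_odd {n j k : ℕ} (hj : j ≤ n) (hk : k < 2 ^ j) :
    bary (sbaRow μ (n + 1)) (j + 1) (2 * k + 1) = sbaPt μ j k := by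
  rw [bary_sbaRow (by omega), node_sbaRow_odd hk, EReal.toReal_coe]

/-- The inversion formula recovers the distribution function of `μ` from its sequential barycenter
array. -/
theorem cdfAt_sbaRow (hΘc : IsClosed Θ) (hΘ : Θ.OrdConnected) (hnt : Θ.Nontrivial)
    (hμ : IsRegular μ) {n j i : ℕ} (hj : j ≤ n) (hi : i ≤ 2 ^ j) :
    cdfAt (bary (sbaRow μ (n + 1))) j i =
      μ.real {t : Θ | ((t : ℝ) : EReal) ≤ node (sbaRow μ j) i} := by
  have := hμ.prob
  induction j generalizing i with
  | zero =>
    obtain rfl | rfl : i = 0 ∨ i = 1 := by rw [pow_zero] at hi; omega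
    -- The start value `0` is correct only because the left endpoint carries no mass.
    · rw [node_zero, measureReal_def, hμ.left]
      simp [cdfAt]
    · have h := node_top (sbaRow μ 0)
      rw [pow_zero] at h
      have : {t : Θ | ((t : ℝ) : EReal) ≤ node (sbaRow μ 0) 1} = Set.univ := by
        ext t
        simp only [Set.mem_ofPred_eq, Set.mem_univ, iff_true, h]
        exact le_sSup ⟨t, t.2, rfl⟩
      rw [this]
      simp [cdfAt]
  | succ j ih =>
    have hp := pow_succ 2 j
    obtain ⟨k, rfl | rfl⟩ := Nat.even_or_odd' i
    · rw [node_sbaRow_even, ← ih (by omega) (by omega)]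
      simp [cdfAt]
    · have hk : k < 2 ^ j := by omega
      -- The three points in the formula are the barycenters of the right half, of the gap itself
      -- and of the left half.
      have h1 : bary (sbaRow μ (n + 1)) (j + 2) (4 * (k + 1) - 1) = sbaPt μ (j + 1) (2 * k + 1) := by
        rw [show 4 * (k + 1) - 1 = 2 * (2 * k + 1) + 1 by omega,
          bary_sbaRow_odd (by omega) (by omega)]
      have h2 : bary (sbaRow μ (n + 1)) (j + 2) (4 * (k + 1) - 2) = sbaPt μ j k := by
        rw [show 4 * (k + 1) - 2 = 2 * (2 * k + 1) by omega, bary_sbaRow (by omega),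
          node_sbaRow_even, node_sbaRow_odd hk, EReal.toReal_coe]
      have h3 : bary (sbaRow μ (n + 1)) (j + 2) (4 * (k + 1) - 3) = sbaPt μ (j + 1) (2 * k) := by
        rw [show 4 * (k + 1) - 3 = 2 * (2 * k) + 1 by omega,
          bary_sbaRow_odd (by omega) (by omega)]
      have e1 : (2 * k + 1) % 2 ≠ 0 := by omega
      have e2 : (2 * k + 1) / 2 = k := by omega
      rw [cdfAt, if_neg e1]
      simp only [e2, h1, h2, h3, Nat.add_sub_cancel]
      rw [ih (by omega) (by omega), ih (by omega) (by omega), ← measureReal_gap hΘc hΘ hnt hμ hk]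
      have hb := barycenter_balance hΘc hΘ hnt hμ hk
      have hs := measureReal_gap_split hΘc hΘ hnt hμ hk
      have hl := measureReal_gap hΘc hΘ hnt hμ (j := j + 1) (k := 2 * k) (by omega)
      rw [node_sbaRow_even] at hl
      have ha := (sbaPt_between hΘc hΘ hnt hμ (j := j + 1) (k := 2 * k) (by omega)).2
      have hc := (sbaPt_between hΘc hΘ hnt hμ (j := j + 1) (k := 2 * k + 1) (by omega)).1
      rw [node_sbaRow_odd hk, EReal.coe_lt_coe_iff] at ha hc
      have hne : (sbaPt μ (j + 1) (2 * k + 1) : ℝ) - sbaPt μ (j + 1) (2 * k) ≠ 0 := by linarith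
      -- What remains is `m_L (b_R - b_L) = (m_L + m_R) (b_R - b)`, a form of the balance identity.
      rw [divOne, if_neg (fun h => hne h.2), hs, sub_eq_iff_eq_add.1 hl.symm]
      field_simp
      linarith

theorem locWeight_sbaRow (hΘc : IsClosed Θ) (hΘ : Θ.OrdConnected) (hnt : Θ.Nontrivial)
    (hμ : IsRegular μ) {n k : ℕ} (hk : k < 2 ^ n) :
    locWeight (sbaRow μ (n + 1)) (k + 1) = μ.real (gap (sbaRow μ n) (k + 1)) := by
  rw [locWeight, Nat.add_sub_cancel, cdfAt_sbaRow hΘc hΘ hnt hμ le_rfl hk,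
    cdfAt_sbaRow hΘc hΘ hnt hμ le_rfl hk.le, measureReal_gap hΘc hΘ hnt hμ hk]

theorem locAtom_sbaRow {n : ℕ} (k : Fin (2 ^ n)) :
    locAtom (sbaRow μ (n + 1)) k = sbaPt μ n k := by
  simp [locAtom, sbaRow, interleave, sbaPt]

end DSBA

/-! ### The mean deviation from the barycenters tends to zero. -/

namespace DSBA

variable {Θ : Set ℝ}

variable [Nonempty Θ] {μ : Measure Θ}

/-- The total deviation of `μ` from the barycenters of the intervals of row `j`. -/
noncomputable def absDev (μ : Measure Θ) (j : ℕ) : ℝ :=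
  ∑ k ∈ Finset.range (2 ^ j), ∫ t in gap (sbaRow μ j) (k + 1), |(t : ℝ) - sbaPt μ j k| ∂μ

/-- The total variance of `μ` within the intervals of row `j`. -/
noncomputable def sqDev (μ : Measure Θ) (j : ℕ) : ℝ :=
  ∑ k ∈ Finset.range (2 ^ j), ∫ t in gap (sbaRow μ j) (k + 1), ((t : ℝ) - sbaPt μ j k) ^ 2 ∂μ

/-- Parallel axis identity: the cross term vanishes at the barycenter. -/
theorem setIntegral_sq_sub (hΘc : IsClosed Θ) (hΘ : Θ.OrdConnected) (hnt : Θ.Nontrivial)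
    (hμ : IsRegular μ) {j k : ℕ} (hk : k < 2 ^ j) (c : ℝ) :
    ∫ t in gap (sbaRow μ j) (k + 1), ((t : ℝ) - c) ^ 2 ∂μ =
      ∫ t in gap (sbaRow μ j) (k + 1), ((t : ℝ) - sbaPt μ j k) ^ 2 ∂μ +
      μ.real (gap (sbaRow μ j) (k + 1)) * (sbaPt μ j k - c) ^ 2 := by
  have := hμ.prob
  set a : ℝ := (sbaPt μ j k : ℝ) with ha
  have h (t : Θ) : ((t : ℝ) - c) ^ 2 =
      ((t : ℝ) - a) ^ 2 + 2 * (a - c) * ((t : ℝ) - a) + (a - c) ^ 2 := by ring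
  have h1 := (hμ.integrable_sq a).integrableOn (s := gap (sbaRow μ j) (k + 1))
  have h2 : IntegrableOn (fun t : Θ => 2 * (a - c) * ((t : ℝ) - a)) (gap (sbaRow μ j) (k + 1)) μ :=
    ((hμ.integrable.sub (integrable_const a)).const_mul (2 * (a - c))).integrableOn
  have h12 : IntegrableOn (fun t : Θ => ((t : ℝ) - a) ^ 2 + 2 * (a - c) * ((t : ℝ) - a))
    (gap (sbaRow μ j) (k + 1)) μ := h1.add h2
  simp_rw [h]
  rw [integral_add h12 (integrable_const _), integral_add h1 h2, integral_const_mul]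
  rw [setIntegral_sub_const hμ.integrable, setIntegral_gap hΘc hΘ hnt hμ hk]
  simp [ha]

/-- The sign of `t - b` is constant on each half of the gap, so the deviation at level `j` depends
only on masses and barycenters of level `j + 1`. -/
theorem setIntegral_abs_sub (hΘc : IsClosed Θ) (hΘ : Θ.OrdConnected) (hnt : Θ.Nontrivial)
    (hμ : IsRegular μ) {j k : ℕ} (hk : k < 2 ^ j) :
    ∫ t in gap (sbaRow μ j) (k + 1), |(t : ℝ) - sbaPt μ j k| ∂μ =
      μ.real (gap (sbaRow μ (j + 1)) (2 * k + 1)) * (sbaPt μ j k - sbaPt μ (j + 1) (2 * k)) +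
      μ.real (gap (sbaRow μ (j + 1)) (2 * k + 1 + 1)) *
        (sbaPt μ (j + 1) (2 * k + 1) - sbaPt μ j k) := by
  have := hμ.prob
  have hp := pow_succ 2 j
  rw [setIntegral_gap_split hΘc hΘ hnt hμ hk (hμ.integrable_abs _)]
  congr 1
  · rw [setIntegral_congr_fun (measurableSet_gap _ _) (g := fun t : Θ => -((t : ℝ) - sbaPt μ j k)),
      integral_neg, setIntegral_sub_const hμ.integrable, setIntegral_gap hΘc hΘ hnt hμ (by omega)]
    · ring
    · intro t ht
      rw [gap_sbaRow_left hΘc hΘ hnt hμ hk] at ht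
      exact abs_of_nonpos (sub_nonpos.2 ht.2)
  · rw [setIntegral_congr_fun (measurableSet_gap _ _) (g := fun t : Θ => (t : ℝ) - sbaPt μ j k),
      setIntegral_sub_const hμ.integrable, setIntegral_gap hΘc hΘ hnt hμ (by omega)]
    · ring
    · intro t ht
      rw [gap_sbaRow_right hΘc hΘ hnt hμ hk] at ht
      exact abs_of_nonneg (sub_nonneg.2 (not_le.1 (Set.notMem_of_mem_compl ht.2)).le)

theorem sum_range_two_mul {M : Type*} [AddCommMonoid M] (f : ℕ → M) (n : ℕ) :
    ∑ k ∈ Finset.range (2 * n), f k = ∑ k ∈ Finset.range n, (f (2 * k) + f (2 * k + 1)) := by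
  induction n with
  | zero => simp
  | succ n ih => rw [Nat.mul_succ, Finset.sum_range_succ, Finset.sum_range_succ, ih,
      Finset.sum_range_succ, add_assoc]

theorem sum_measureReal_gap (hΘc : IsClosed Θ) (hΘ : Θ.OrdConnected) (hnt : Θ.Nontrivial)
    (hμ : IsRegular μ) (j : ℕ) :
    ∑ k ∈ Finset.range (2 ^ j), μ.real (gap (sbaRow μ j) (k + 1)) = 1 := by
  have := hμ.prob
  rw [Finset.sum_congr rfl fun k hk => measureReal_gap hΘc hΘ hnt hμ (Finset.mem_range.1 hk),
    Finset.sum_range_sub fun k => μ.real {t : Θ | ((t : ℝ) : EReal) ≤ node (sbaRow μ j) k},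
    node_zero, node_top, measureReal_def (s := {t : Θ | ((t : ℝ) : EReal) ≤ sInf ((fun t : ℝ => (t : EReal)) '' Θ)}),
    hμ.left]
  have : {t : Θ | ((t : ℝ) : EReal) ≤ sSup ((fun t : ℝ => (t : EReal)) '' Θ)} = Set.univ := by
    ext t
    simp only [Set.mem_ofPred_eq, Set.mem_univ, iff_true]
    exact le_sSup (Set.mem_image_of_mem _ t.2)
  simp [this]

theorem sqDev_nonneg (μ : Measure Θ) (j : ℕ) : 0 ≤ sqDev μ j :=
  Finset.sum_nonneg fun _ _ => integral_nonneg fun _ => sq_nonneg _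

theorem absDev_nonneg (μ : Measure Θ) (j : ℕ) : 0 ≤ absDev μ j :=
  Finset.sum_nonneg fun _ _ => integral_nonneg fun _ => abs_nonneg _

/-- Pythagoras for variances: splitting the gaps removes precisely the variance of the new
barycenters about the old ones. -/
theorem sqDev_sub (hΘc : IsClosed Θ) (hΘ : Θ.OrdConnected) (hnt : Θ.Nontrivial)
    (hμ : IsRegular μ) (j : ℕ) : sqDev μ j - sqDev μ (j + 1) = ∑ k ∈ Finset.range (2 ^ j),
      (μ.real (gap (sbaRow μ (j + 1)) (2 * k + 1)) *
          (sbaPt μ (j + 1) (2 * k) - sbaPt μ j k) ^ 2 +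
        μ.real (gap (sbaRow μ (j + 1)) (2 * k + 1 + 1)) *
          (sbaPt μ (j + 1) (2 * k + 1) - sbaPt μ j k) ^ 2) := by
  have hp := pow_succ 2 j
  rw [sqDev, sqDev, pow_succ', sum_range_two_mul, ← Finset.sum_sub_distrib]
  refine Finset.sum_congr rfl fun k hk => ?_
  have hk := Finset.mem_range.1 hk
  rw [setIntegral_gap_split hΘc hΘ hnt hμ hk (hμ.integrable_sq _),
    setIntegral_sq_sub hΘc hΘ hnt hμ (by omega) (sbaPt μ j k : ℝ),
    setIntegral_sq_sub hΘc hΘ hnt hμ (by omega) (sbaPt μ j k : ℝ)]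
  ring

theorem absDev_le (hΘc : IsClosed Θ) (hΘ : Θ.OrdConnected) (hnt : Θ.Nontrivial)
    (hμ : IsRegular μ) (j : ℕ) {δ : ℝ} (hδ : 0 < δ) :
    absDev μ j ≤ δ / 2 + (sqDev μ j - sqDev μ (j + 1)) / (2 * δ) := by
  have key (u : ℝ) : |u| ≤ δ / 2 + u ^ 2 / (2 * δ) := by
    have h : δ / 2 + u ^ 2 / (2 * δ) - |u| = (|u| - δ) ^ 2 / (2 * δ) := by
      field_simp
      rw [← sq_abs u]
      ring
    have : 0 ≤ (|u| - δ) ^ 2 / (2 * δ) := by positivity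
    linarith
  have hs := sum_measureReal_gap hΘc hΘ hnt hμ (j + 1)
  rw [pow_succ', sum_range_two_mul] at hs
  -- The constant `δ / 2` is spread over the gaps of level `j + 1`, whose masses sum to `1`, so that
  -- `key` applies term by term.
  rw [sqDev_sub hΘc hΘ hnt hμ, absDev, ← mul_one (δ / 2), ← hs, Finset.mul_sum, Finset.sum_div,
    ← Finset.sum_add_distrib]
  refine Finset.sum_le_sum fun k hk => ?_
  rw [setIntegral_abs_sub hΘc hΘ hnt hμ (Finset.mem_range.1 hk)]
  have h1 := mul_le_mul_of_nonneg_left ((neg_le_abs _).trans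
    (key (sbaPt μ (j + 1) (2 * k) - sbaPt μ j k)))
    (measureReal_nonneg (μ := μ) (s := gap (sbaRow μ (j + 1)) (2 * k + 1)))
  have h2 := mul_le_mul_of_nonneg_left ((le_abs_self _).trans
    (key (sbaPt μ (j + 1) (2 * k + 1) - sbaPt μ j k)))
    (measureReal_nonneg (μ := μ) (s := gap (sbaRow μ (j + 1)) (2 * k + 1 + 1)))
  refine (le_of_eq ?_).trans ((add_le_add h1 h2).trans (le_of_eq ?_)) <;> ring

theorem tendsto_absDev (hΘc : IsClosed Θ) (hΘ : Θ.OrdConnected) (hnt : Θ.Nontrivial)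
    (hμ : IsRegular μ) : Tendsto (absDev μ) atTop (𝓝 0) := by
  have hanti : Antitone (sqDev μ) := antitone_nat_of_succ_le fun j => by
    rw [← sub_nonneg, sqDev_sub hΘc hΘ hnt hμ]
    exact Finset.sum_nonneg fun k _ => by positivity
  have hlim := tendsto_atTop_ciInf hanti ⟨0, by rintro _ ⟨j, rfl⟩; exact sqDev_nonneg μ j⟩
  have hdiff := hlim.sub (hlim.comp (tendsto_add_atTop_nat 1))
  rw [sub_self] at hdiff
  rw [Metric.tendsto_atTop]
  intro δ hδ
  -- A variance drop below `δ ^ 2` makes the second term of `absDev_le` smaller than `δ / 2`.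
  obtain ⟨N, hN⟩ := Metric.tendsto_atTop.1 hdiff (δ ^ 2) (by positivity)
  refine ⟨N, fun n hn => ?_⟩
  have h1 := hN n hn
  simp only [Function.comp_apply, Real.dist_eq, sub_zero] at h1
  have h2 := absDev_le hΘc hΘ hnt hμ n hδ
  rw [Real.dist_eq, sub_zero, abs_of_nonneg (absDev_nonneg μ n)]
  have h3 : (sqDev μ n - sqDev μ (n + 1)) / (2 * δ) < δ / 2 := by
    rw [div_lt_div_iff₀ (by positivity) two_pos]
    nlinarith [(le_abs_self _).trans_lt h1]
  linarith

end DSBA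

/-! ### Discretization of a measure with finitely many scales. -/

namespace DSBA

variable {Θ : Set ℝ}

theorem integral_discreteMeasure {n m : ℕ} (x : Row Θ (n + 1)) (φ : Fin m → ℝ≥0)
    (w : Fin (2 ^ n) → Fin m → ℝ) {f : Θ × ℝ≥0 → ℝ} (hf : Continuous f) :
    ∫ a, f a ∂(discreteMeasure x φ w) = ∑ k₁ : Fin (2 ^ n), ∑ k₂ : Fin m,
      (ENNReal.ofReal (locWeight x ((k₁ : ℕ) + 1) * w k₁ k₂)).toReal * f (locAtom x k₁, φ k₂) := by
  have hi (c : ℝ) (a : Θ × ℝ≥0) : Integrable f (ENNReal.ofReal c • Measure.dirac a) :=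
    (integrable_dirac' hf.stronglyMeasurable (by finiteness)).smul_measure ENNReal.ofReal_ne_top
  rw [discreteMeasure, integral_finsetSum_measure fun i _ => integrable_finsetSum_measure.2
    fun j _ => hi _ _]
  refine Finset.sum_congr rfl fun i _ => ?_
  rw [integral_finsetSum_measure fun j _ => hi _ _]
  refine Finset.sum_congr rfl fun j _ => ?_
  rw [integral_smul_measure, integral_dirac' _ _ hf.stronglyMeasurable, smul_eq_mul]

theorem setIntegral_prod_univ {m : ℕ} {ν : Measure (Θ × ℝ≥0)} {φ : Fin m → ℝ≥0}
    (hinj : Function.Injective φ) (hφ : ∀ᵐ p ∂ν, p.2 ∈ Set.range φ) {s : Set Θ}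
    (hs : MeasurableSet s) {f : Θ × ℝ≥0 → ℝ} (hf : Integrable f ν) :
    ∫ p in s ×ˢ Set.univ, f p ∂ν = ∑ i, ∫ p in s ×ˢ {φ i}, f p ∂ν := by
  rw [← integral_iUnion_fintype (fun i => hs.prod (measurableSet_singleton _))
    (fun i j hij => ?_) fun i => hf.integrableOn]
  · refine setIntegral_congr_set ?_
    filter_upwards [hφ] with p hp
    refine propext ⟨fun h => ?_, fun h => ?_⟩
    · obtain ⟨i, hi⟩ := hp
      exact Set.mem_iUnion.2 ⟨i, h.1, hi.symm⟩
    · obtain ⟨i, hi⟩ := Set.mem_iUnion.1 h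
      exact ⟨hi.1, trivial⟩
  · refine Set.disjoint_left.2 fun p h1 h2 => hij (hinj ?_)
    exact (h1.2 : p.2 = φ i).symm.trans h2.2

variable [Nonempty Θ] {ν : Measure (Θ × ℝ≥0)}

theorem integral_eq_sum_gap (hΘc : IsClosed Θ) (hΘ : Θ.OrdConnected) (hnt : Θ.Nontrivial)
    (hμ : IsRegular (ν.map Prod.fst)) {f : Θ × ℝ≥0 → ℝ} (hf : Integrable f ν) (j : ℕ) :
    ∫ p, f p ∂ν = ∑ k ∈ Finset.range (2 ^ j),
      ∫ p in gap (sbaRow (ν.map Prod.fst) j) (k + 1) ×ˢ Set.univ, f p ∂ν := by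
  set μ := ν.map Prod.fst with hμ_def
  induction j with
  | zero =>
    rw [pow_zero, Finset.sum_range_one, ← setIntegral_univ]
    refine setIntegral_congr_set ?_
    -- The single gap of row `0` is open on the left, so it misses only the left endpoint, a null
    -- set.
    have h0 : ∀ᵐ p ∂ν,
        p.1 ∉ {t : Θ | ((t : ℝ) : EReal) ≤ sInf ((fun t : ℝ => (t : EReal)) '' Θ)} :=
      ae_of_ae_map measurable_fst.aemeasurable (measure_eq_zero_iff_ae_notMem.1 hμ.left)
    filter_upwards [h0] with p hp
    refine propext ⟨fun _ => ⟨⟨?_, ?_⟩, trivial⟩, fun _ => trivial⟩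
    · rw [Nat.add_sub_cancel, node_zero]
      exact not_le.1 hp
    · have := node_top (sbaRow μ 0)
      rw [pow_zero] at this
      rw [zero_add, this]
      exact le_sSup (Set.mem_image_of_mem _ p.1.2)
  | succ j ih =>
    rw [ih, pow_succ', sum_range_two_mul]
    refine Finset.sum_congr rfl fun k hk => ?_
    have hk := Finset.mem_range.1 hk
    rw [gap_sbaRow_left hΘc hΘ hnt hμ hk, gap_sbaRow_right hΘc hΘ hnt hμ hk, ← Set.sdiff_eq,
      ← integral_inter_add_sdiff (t := Set.Iic (sbaPt μ j k) ×ˢ (Set.univ : Set ℝ≥0))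
        (measurableSet_Iic.prod MeasurableSet.univ) hf.integrableOn]
    congr 3 <;> ext p <;> simp

/-- The scale weights that turn the sequential barycenter array of the first marginal of `ν` into a
discretization of `ν`. -/
noncomputable def scaleWeight (ν : Measure (Θ × ℝ≥0)) {m : ℕ} (φ : Fin m → ℝ≥0) (n : ℕ)
    (k : Fin (2 ^ n)) (i : Fin m) : ℝ :=
  ν.real (gap (sbaRow (ν.map Prod.fst) n) (k + 1) ×ˢ {φ i}) /
    (ν.map Prod.fst).real (gap (sbaRow (ν.map Prod.fst) n) (k + 1))

theorem scaleWeight_mem_stdSimplex (hΘc : IsClosed Θ) (hΘ : Θ.OrdConnected) (hnt : Θ.Nontrivial)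
    [IsFiniteMeasure ν] (hμ : IsRegular (ν.map Prod.fst)) {m : ℕ} {φ : Fin m → ℝ≥0}
    (hinj : Function.Injective φ) (hφ : ∀ᵐ p ∂ν, p.2 ∈ Set.range φ) (n : ℕ) (k : Fin (2 ^ n)) :
    scaleWeight ν φ n k ∈ stdSimplex ℝ (Fin m) := by
  refine ⟨fun i => by unfold scaleWeight; positivity, ?_⟩
  have h := setIntegral_prod_univ hinj hφ
    (measurableSet_gap (sbaRow (ν.map Prod.fst) n) (k + 1)) (integrable_const (1 : ℝ))
  simp only [setIntegral_const, smul_eq_mul, mul_one] at h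
  simp only [scaleWeight]
  have := hμ.prob
  have h0 := measure_gap_sbaRow_ne_zero hΘc hΘ hnt hμ k.2
  rw [← Finset.sum_div, ← h, div_eq_one_iff_eq ((measureReal_ne_zero_iff (measure_ne_top _ _)).2 h0),
    map_measureReal_apply measurable_fst (measurableSet_gap _ _), Set.prod_univ]

theorem locWeight_mul_scaleWeight (hΘc : IsClosed Θ) (hΘ : Θ.OrdConnected) (hnt : Θ.Nontrivial)
    (hμ : IsRegular (ν.map Prod.fst)) {m : ℕ} (φ : Fin m → ℝ≥0) (n : ℕ) (k : Fin (2 ^ n))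
    (i : Fin m) :
    locWeight (sbaRow (ν.map Prod.fst) (n + 1)) (k + 1) * scaleWeight ν φ n k i =
      ν.real (gap (sbaRow (ν.map Prod.fst) n) (k + 1) ×ˢ {φ i}) := by
  have := hμ.prob
  have h0 := measure_gap_sbaRow_ne_zero hΘc hΘ hnt hμ k.2
  rw [locWeight_sbaRow hΘc hΘ hnt hμ k.2, scaleWeight, mul_div_cancel₀ _
    ((measureReal_ne_zero_iff (measure_ne_top _ _)).2 h0)]

/-- The discretization of `ν` at level `n`. -/
noncomputable def discretization (ν : Measure (Θ × ℝ≥0)) {m : ℕ} (φ : Fin m → ℝ≥0) (n : ℕ) :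
    Measure (Θ × ℝ≥0) :=
  discreteMeasure (sbaRow (ν.map Prod.fst) (n + 1)) φ (scaleWeight ν φ n)

theorem integral_discretization (hΘc : IsClosed Θ) (hΘ : Θ.OrdConnected) (hnt : Θ.Nontrivial)
    (hμ : IsRegular (ν.map Prod.fst)) {m : ℕ} (φ : Fin m → ℝ≥0) (n : ℕ) {f : Θ × ℝ≥0 → ℝ}
    (hf : Continuous f) :
    ∫ p, f p ∂(discretization ν φ n) = ∑ k ∈ Finset.range (2 ^ n), ∑ i : Fin m,
      ν.real (gap (sbaRow (ν.map Prod.fst) n) (k + 1) ×ˢ {φ i}) *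
        f (sbaPt (ν.map Prod.fst) n k, φ i) := by
  rw [discretization, integral_discreteMeasure _ _ _ hf, Finset.sum_range]
  refine Finset.sum_congr rfl fun k _ => Finset.sum_congr rfl fun i _ => ?_
  rw [locWeight_mul_scaleWeight hΘc hΘ hnt hμ, ENNReal.toReal_ofReal measureReal_nonneg,
    locAtom_sbaRow]

theorem isProbabilityMeasure_discretization (hΘc : IsClosed Θ) (hΘ : Θ.OrdConnected)
    (hnt : Θ.Nontrivial) [IsProbabilityMeasure ν] (hμ : IsRegular (ν.map Prod.fst)) {m : ℕ}
    {φ : Fin m → ℝ≥0} (hinj : Function.Injective φ) (hφ : ∀ᵐ p ∂ν, p.2 ∈ Set.range φ) (n : ℕ) :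
    IsProbabilityMeasure (discretization ν φ n) := by
  have h1 := integral_discretization hΘc hΘ hnt hμ φ n (continuous_const (y := (1 : ℝ)))
  have h2 := integral_eq_sum_gap hΘc hΘ hnt hμ (integrable_const (1 : ℝ)) n
  simp_rw [setIntegral_prod_univ hinj hφ (measurableSet_gap _ _) (integrable_const (1 : ℝ))] at h2
  simp only [integral_const, smul_eq_mul, mul_one, probReal_univ,
    measureReal_restrict_apply_univ] at h1 h2
  rw [← h2, measureReal_def, ENNReal.toReal_eq_one_iff] at h1
  exact ⟨h1⟩

/-- The mass of each cell, a gap times one scale, moves to the barycenter of the gap at the same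
scale. In the max metric the displacement is therefore purely in the location. -/
theorem abs_integral_sub_discretization_le (hΘc : IsClosed Θ) (hΘ : Θ.OrdConnected)
    (hnt : Θ.Nontrivial) [IsProbabilityMeasure ν] (hμ : IsRegular (ν.map Prod.fst)) {m : ℕ}
    {φ : Fin m → ℝ≥0} (hinj : Function.Injective φ) (hφ : ∀ᵐ p ∂ν, p.2 ∈ Set.range φ) (n : ℕ)
    {f : Θ × ℝ≥0 → ℝ} {L : ℝ≥0} (hL : LipschitzWith L f) (hf : Integrable f ν) :
    |∫ p, f p ∂ν - ∫ p, f p ∂(discretization ν φ n)| ≤ L * absDev (ν.map Prod.fst) n := by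
  set μ := ν.map Prod.fst with hμ_def
  have hI (c : ℝ) : Integrable (fun p : Θ × ℝ≥0 => L * |(p.1 : ℝ) - c|) ν :=
    (((hμ.integrable_abs c).comp_measurable measurable_fst)).const_mul _
  rw [integral_discretization hΘc hΘ hnt hμ φ n hL.continuous,
    integral_eq_sum_gap hΘc hΘ hnt hμ hf n, ← Finset.sum_sub_distrib, absDev, Finset.mul_sum]
  refine (Finset.abs_sum_le_sum_abs _ _).trans (Finset.sum_le_sum fun k _ => ?_)
  have hR : L * ∫ t in gap (sbaRow μ n) (k + 1), |(t : ℝ) - sbaPt μ n k| ∂μ =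
      ∫ p in gap (sbaRow μ n) (k + 1) ×ˢ Set.univ, L * |(p.1 : ℝ) - sbaPt μ n k| ∂ν := by
    rw [integral_const_mul, hμ_def, setIntegral_map (measurableSet_gap _ _)
      (Measurable.aestronglyMeasurable (by fun_prop)) measurable_fst.aemeasurable, Set.prod_univ]
  rw [← hμ_def, hR, setIntegral_prod_univ hinj hφ (measurableSet_gap _ _) hf,
    setIntegral_prod_univ hinj hφ (measurableSet_gap _ _) (hI _), ← Finset.sum_sub_distrib]
  refine (Finset.abs_sum_le_sum_abs _ _).trans (Finset.sum_le_sum fun i _ => ?_)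
  have hsub : ∫ p in gap (sbaRow μ n) (k + 1) ×ˢ {φ i}, (f p - f (sbaPt μ n k, φ i)) ∂ν =
      ∫ p in gap (sbaRow μ n) (k + 1) ×ˢ {φ i}, f p ∂ν -
        ν.real (gap (sbaRow μ n) (k + 1) ×ˢ {φ i}) * f (sbaPt μ n k, φ i) := by
    rw [integral_sub hf.integrableOn (integrable_const _)]
    simp
  rw [← hsub]
  have hms : MeasurableSet (gap (sbaRow μ n) (k + 1) ×ˢ {φ i}) :=
    (measurableSet_gap _ _).prod (measurableSet_singleton _)
  refine abs_integral_le_integral_abs.trans (setIntegral_mono_on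
    (hf.integrableOn.sub (integrable_const _)).abs (hI _).integrableOn hms fun p hp => ?_)
  have h2 : p.2 = φ i := hp.2
  have := hL.dist_le_mul p (sbaPt μ n k, φ i)
  rwa [Real.dist_eq, Prod.dist_eq, h2, dist_self, max_eq_left dist_nonneg, Subtype.dist_eq,
    Real.dist_eq] at this

end DSBA

/-! ### Density of discretizations in the weak topology. -/

namespace DSBA

variable {Θ : Set ℝ}

/-- The witness is a standard Gaussian conditioned on `Θ`. A nondegenerate interval lies in the
closure of its interior, which gives full support; absence of atoms handles the left endpoint. -/
theorem exists_isRegular (hΘc : IsClosed Θ) (hΘ : Θ.OrdConnected) (hnt : Θ.Nontrivial) :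
    ∃ γ : Measure Θ, IsRegular γ := by
  set g : Measure Θ := (gaussianReal 0 1).comap Subtype.val with hg
  have hemb : MeasurableEmbedding (Subtype.val : Θ → ℝ) :=
    MeasurableEmbedding.subtype_coe hΘc.measurableSet
  have hmap : g.map Subtype.val = (gaussianReal 0 1).restrict Θ :=
    map_comap_subtype_coe hΘc.measurableSet _
  have hopen : (gaussianReal 0 1).IsOpenPosMeasure :=
    (gaussianReal_absolutelyContinuous' 0 one_ne_zero).isOpenPosMeasure
  have : NullSingletonClass (gaussianReal 0 1) := nullSingletonClass_gaussianReal one_ne_zero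
  have hcl : Θ ⊆ closure (interior Θ) := by
    obtain ⟨a, ha, b, hb, hab⟩ := hnt.exists_lt
    have hne : (interior Θ).Nonempty := by
      obtain ⟨c, hc⟩ := exists_between hab
      exact ⟨c, mem_interior.2 ⟨Set.Ioo a b, Set.Ioo_subset_Icc_self.trans (hΘ.out ha hb),
        isOpen_Ioo, hc⟩⟩
    have hcv : Convex ℝ Θ := hΘ.convex
    rw [hcv.closure_interior_eq_closure_of_nonempty_interior hne]
    exact subset_closure
  have hgpos : g.IsOpenPosMeasure := by
    refine ⟨fun U hU ⟨t, ht⟩ => ?_⟩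
    obtain ⟨V, hV, rfl⟩ := isOpen_induced_iff.1 hU
    rw [hg, hemb.comap_apply, Subtype.image_preimage_val]
    have hne : (V ∩ interior Θ).Nonempty := mem_closure_iff.1 (hcl t.2) V hV ht
    have hsub : V ∩ interior Θ ⊆ Θ ∩ V := fun x hx => ⟨interior_subset hx.2, hx.1⟩
    exact (((hV.inter isOpen_interior).measure_pos (gaussianReal 0 1) hne).trans_le
      (measure_mono hsub)).ne'
  have : IsFiniteMeasure g := ⟨by
    rw [hg, hemb.comap_apply]; exact measure_lt_top _ _⟩
  obtain ⟨t₀, ht₀⟩ := hnt.nonempty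
  have hne : g Set.univ ≠ 0 := isOpen_univ.measure_ne_zero g ⟨⟨t₀, ht₀⟩, trivial⟩
  have hinv : (g Set.univ)⁻¹ ≠ ∞ := ENNReal.inv_ne_top.2 hne
  refine ⟨(g Set.univ)⁻¹ • g, ⟨?_, ?_, ?_, ?_⟩⟩
  · exact ⟨by simp [ENNReal.inv_mul_cancel hne (measure_ne_top _ _)]⟩
  · exact Measure.isOpenPosMeasure_smul g (ENNReal.inv_ne_zero.2 (measure_ne_top _ _))
  · refine MemLp.smul_measure ?_ hinv
    have h : MemLp id 2 (g.map (Subtype.val : Θ → ℝ)) := by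
      rw [hmap]
      exact (memLp_id_gaussianReal' 2 (by simp)).restrict Θ
    exact (memLp_map_measure_iff (by fun_prop) (by fun_prop) (f := Subtype.val)).1 h
  · suffices h : g {t : Θ | ((t : ℝ) : EReal) ≤ sInf ((fun t : ℝ => (t : EReal)) '' Θ)} = 0 by
      rw [Measure.smul_apply, h, smul_zero]
    rw [hg, hemb.comap_apply]
    refine Set.Subsingleton.measure_zero ?_ _
    rintro _ ⟨s, hs, rfl⟩ _ ⟨t, ht, rfl⟩
    have h1 : ((s : ℝ) : EReal) ≤ ((t : ℝ) : EReal) :=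
      le_trans hs (sInf_le (Set.mem_image_of_mem _ t.2))
    have h2 : ((t : ℝ) : EReal) ≤ ((s : ℝ) : EReal) :=
      le_trans ht (sInf_le (Set.mem_image_of_mem _ s.2))
    exact le_antisymm (EReal.coe_le_coe_iff.1 h1) (EReal.coe_le_coe_iff.1 h2)

theorem dense_sInf_lt {γ : Measure Θ} (hγ : IsRegular γ) (p : Θ × ℝ≥0) :
    p ∈ closure {p : Θ × ℝ≥0 | sInf ((fun t : ℝ => (t : EReal)) '' Θ) < ((p.1 : ℝ) : EReal)} := by
  have := hγ.openPos
  have h : Dense {t : Θ | sInf ((fun t : ℝ => (t : EReal)) '' Θ) < ((t : ℝ) : EReal)} := by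
    refine Measure.dense_of_ae (μ := γ) ?_
    filter_upwards [measure_eq_zero_iff_ae_notMem.1 hγ.left] with t ht
    exact not_le.1 ht
  have h' := h.prod (dense_univ (X := ℝ≥0))
  have hset : {p : Θ × ℝ≥0 | sInf ((fun t : ℝ => (t : EReal)) '' Θ) < ((p.1 : ℝ) : EReal)} =
      {t : Θ | sInf ((fun t : ℝ => (t : EReal)) '' Θ) < ((t : ℝ) : EReal)} ×ˢ Set.univ := by
    ext; simp
  rw [hset]
  exact h' p

/-- The mixture of a finitely supported pushforward of `ν` with a measure whose first marginal is
`γ`. -/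
noncomputable def mixture (γ : Measure Θ) (ν : Measure (Θ × ℝ≥0))
    (g : Θ × ℝ≥0 → Θ × ℝ≥0) (q : ℝ) : Measure (Θ × ℝ≥0) :=
  ENNReal.ofReal (1 - q) • ν.map g + ENNReal.ofReal q • γ.prod (Measure.dirac 0)

variable {γ : Measure Θ} {ν : Measure (Θ × ℝ≥0)} {g : SimpleFunc (Θ × ℝ≥0) (Θ × ℝ≥0)} {q : ℝ}

theorem mixture_map_fst (hγ : IsRegular γ) : (mixture γ ν g q).map Prod.fst =
    ENNReal.ofReal (1 - q) • ν.map (fun p => (g p).1) + ENNReal.ofReal q • γ := by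
  have := hγ.prob
  rw [mixture, Measure.map_add _ _ measurable_fst, Measure.map_smul, Measure.map_smul,
    Measure.map_map measurable_fst g.measurable, Measure.map_fst_prod, measure_univ, one_smul]
  rfl

variable [IsProbabilityMeasure ν]

theorem isProbabilityMeasure_mixture (hγ : IsRegular γ) (hq0 : 0 ≤ q) (hq1 : q ≤ 1) :
    IsProbabilityMeasure (mixture γ ν g q) := by
  have := hγ.prob
  have := Measure.isProbabilityMeasure_map (μ := ν) g.measurable.aemeasurable
  refine ⟨?_⟩
  simp only [mixture, Measure.add_apply, Measure.smul_apply, measure_univ, smul_eq_mul, mul_one]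
  rw [← ENNReal.ofReal_add (by linarith) hq0]
  simp

/-- The `γ` part provides full support; the other part has finitely many values, hence all moments,
and avoids the left endpoint. -/
theorem isRegular_mixture (hγ : IsRegular γ) (hq0 : 0 < q) (hq1 : q ≤ 1)
    (hg : ∀ p, sInf ((fun t : ℝ => (t : EReal)) '' Θ) < (((g p).1 : ℝ) : EReal)) :
    IsRegular ((mixture γ ν g q).map Prod.fst) := by
  have := hγ.prob
  have := hγ.openPos
  have hm : Measurable fun p => (g p).1 := measurable_fst.comp g.measurable
  have := isProbabilityMeasure_mixture (ν := ν) (g := g) hγ hq0.le hq1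
  have hprob : IsProbabilityMeasure ((mixture γ ν g q).map Prod.fst) :=
    Measure.isProbabilityMeasure_map measurable_fst.aemeasurable
  refine ⟨hprob, ?_, ?_, ?_⟩
  · rw [mixture_map_fst hγ]
    have h1 := Measure.isOpenPosMeasure_smul γ (ENNReal.ofReal_pos.2 hq0).ne'
    have hle : ENNReal.ofReal q • γ ≤
        ENNReal.ofReal (1 - q) • ν.map (fun p => (g p).1) + ENNReal.ofReal q • γ :=
      Measure.le_add_left le_rfl
    exact hle.isOpenPosMeasure
  · have hms : AEStronglyMeasurable (fun t : Θ => (t : ℝ)) ((mixture γ ν g q).map Prod.fst) :=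
      Measurable.aestronglyMeasurable (by fun_prop)
    rw [memLp_two_iff_integrable_sq hms, mixture_map_fst hγ]
    refine Integrable.add_measure (Integrable.smul_measure ?_ ENNReal.ofReal_ne_top)
      (Integrable.smul_measure hγ.memLp.integrable_sq ENNReal.ofReal_ne_top)
    refine (integrable_map_measure (Measurable.aestronglyMeasurable (by fun_prop))
      hm.aemeasurable).2 ?_
    exact SimpleFunc.integrable_of_isFiniteMeasure (μ := ν) (g.map fun p => (p.1 : ℝ) ^ 2)
  · rw [mixture_map_fst hγ, Measure.add_apply, Measure.smul_apply, Measure.smul_apply, hγ.left,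
      Measure.map_apply hm (measurableSet_le continuous_coe_ereal.measurable measurable_const)]
    have : (fun p => (g p).1) ⁻¹'
        {t : Θ | ((t : ℝ) : EReal) ≤ sInf ((fun t : ℝ => (t : EReal)) '' Θ)} = ∅ :=
      Set.eq_empty_of_forall_notMem fun p hp => (not_le.2 (hg p)) hp
    rw [this, measure_empty, smul_zero, smul_zero, add_zero]

theorem exists_scales_mixture (γ : Measure Θ) [SFinite γ] (ν : Measure (Θ × ℝ≥0))
    (g : SimpleFunc (Θ × ℝ≥0) (Θ × ℝ≥0)) (q : ℝ) :
    ∃ (m : ℕ) (φ : Fin m → ℝ≥0), 1 ≤ m ∧ Function.Injective φ ∧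
      ∀ᵐ p ∂(mixture γ ν g q), p.2 ∈ Set.range φ := by
  classical
  -- The scale `0` belongs to the `γ` part, the others are the values of `g`.
  set F : Finset ℝ≥0 := insert 0 (g.map Prod.snd).range with hF
  refine ⟨F.card, fun i => F.equivFin.symm i, Finset.card_pos.2 ⟨0, Finset.mem_insert_self _ _⟩,
    fun i j h => F.equivFin.symm.injective (Subtype.ext h), ?_⟩
  have hr : Set.range (fun i => (F.equivFin.symm i : ℝ≥0)) = F := by
    ext s
    refine ⟨?_, fun hs => ⟨F.equivFin ⟨s, hs⟩, by simp⟩⟩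
    rintro ⟨i, rfl⟩
    exact (F.equivFin.symm i).2
  have hms : MeasurableSet {p : Θ × ℝ≥0 | p.2 ∈ (F : Set ℝ≥0)} :=
    measurable_snd F.measurableSet
  rw [hr, mixture, ae_add_measure_iff]
  refine ⟨Measure.ae_smul_measure ?_ _, Measure.ae_smul_measure ?_ _⟩
  · rw [ae_map_iff g.measurable.aemeasurable hms]
    refine ae_of_all _ fun p => ?_
    exact Finset.mem_insert_of_mem (SimpleFunc.mem_range_self (g.map Prod.snd) p)
  · rw [Measure.prod_dirac, ae_map_iff (by fun_prop) hms]
    exact ae_of_all _ fun p => by simp [hF]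

/-- A closed set of probability measures is everything as soon as it contains all discretizations
of mixtures. -/
theorem eq_univ_of_isClosed_of_discretization_mem [Nonempty Θ] (hΘc : IsClosed Θ)
    (hΘ : Θ.OrdConnected) (hnt : Θ.Nontrivial) {C : Set (ProbabilityMeasure (Θ × ℝ≥0))}
    (hC : IsClosed C)
    (h : ∀ (ν : ProbabilityMeasure (Θ × ℝ≥0)), IsRegular ((ν : Measure (Θ × ℝ≥0)).map Prod.fst) →
      ∀ (m : ℕ) (φ : Fin m → ℝ≥0), 1 ≤ m → Function.Injective φ →
      (∀ᵐ p ∂(ν : Measure (Θ × ℝ≥0)), p.2 ∈ Set.range φ) → ∀ n, 1 ≤ n →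
      ∀ Q : ProbabilityMeasure (Θ × ℝ≥0),
      (Q : Measure (Θ × ℝ≥0)) = discretization (ν : Measure (Θ × ℝ≥0)) φ n → Q ∈ C) :
    C = Set.univ := by
  have hregular (ν : ProbabilityMeasure (Θ × ℝ≥0))
      (hν : IsRegular ((ν : Measure (Θ × ℝ≥0)).map Prod.fst)) (m : ℕ) (φ : Fin m → ℝ≥0)
      (hm : 1 ≤ m) (hinj : Function.Injective φ)
      (hφ : ∀ᵐ p ∂(ν : Measure (Θ × ℝ≥0)), p.2 ∈ Set.range φ) : ν ∈ C := by
    let Q : ℕ → ProbabilityMeasure (Θ × ℝ≥0) := fun n =>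
      ⟨discretization (ν : Measure (Θ × ℝ≥0)) φ n,
        isProbabilityMeasure_discretization hΘc hΘ hnt hν hinj hφ n⟩
    refine hC.mem_of_tendsto (f := Q) (b := atTop) ?_
      ((eventually_ge_atTop 1).mono fun n hn => h ν hν m φ hm hinj hφ n hn (Q n) rfl)
    -- Bounded Lipschitz functions determine weak convergence, and for these the error bound is
    -- available.
    rw [tendsto_iff_forall_lipschitz_integral_tendsto]
    rintro f ⟨B, hB⟩ ⟨L, hL⟩
    have hfi : Integrable f (ν : Measure (Θ × ℝ≥0)) := by
      obtain ⟨t₀⟩ := ‹Nonempty Θ›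
      refine Integrable.of_bound hL.continuous.aestronglyMeasurable (|f (t₀, 0)| + B)
        (ae_of_all _ fun p => ?_)
      have := hB p (t₀, 0)
      rw [Real.dist_eq] at this
      rw [Real.norm_eq_abs]
      calc |f p| = |f (t₀, 0) + (f p - f (t₀, 0))| := by ring_nf
        _ ≤ _ := (abs_add_le _ _).trans (by linarith)
    rw [tendsto_iff_dist_tendsto_zero]
    refine squeeze_zero (fun _ => dist_nonneg) (fun n => ?_)
      (by simpa using (tendsto_absDev hΘc hΘ hnt hν).const_mul (L : ℝ))
    rw [dist_comm, Real.dist_eq]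
    exact abs_integral_sub_discretization_le hΘc hΘ hnt hν hinj hφ n hL hfi
  obtain ⟨γ, hγ⟩ := exists_isRegular hΘc hΘ hnt
  have := hγ.prob
  have := hγ.openPos
  refine Set.eq_univ_of_forall fun ν => ?_
  set s := {p : Θ × ℝ≥0 | sInf ((fun t : ℝ => (t : EReal)) '' Θ) < ((p.1 : ℝ) : EReal)} with hs
  obtain ⟨p₀, hp₀⟩ : s.Nonempty := closure_nonempty_iff.1
    ⟨_, dense_sInf_lt hγ (Classical.arbitrary (Θ × ℝ≥0))⟩
  -- Simple functions converging pointwise to the identity, with values off the left endpoint; this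
  -- is possible because `s` is dense.
  let g : ℕ → SimpleFunc (Θ × ℝ≥0) (Θ × ℝ≥0) := SimpleFunc.approxOn id measurable_id s p₀ hp₀
  let q : ℕ → ℝ := fun k => 1 / ((k : ℝ) + 1)
  have hq0 (k : ℕ) : 0 < q k := by positivity
  have hq1 (k : ℕ) : q k ≤ 1 := by
    simp only [q]
    rw [div_le_one (by positivity)]
    linarith [Nat.cast_nonneg (α := ℝ) k]
  have hqlim : Tendsto q atTop (𝓝 0) := tendsto_one_div_add_atTop_nhds_zero_nat
  have hprob (k : ℕ) : IsProbabilityMeasure (mixture γ (ν : Measure (Θ × ℝ≥0)) (g k) (q k)) :=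
    isProbabilityMeasure_mixture hγ (hq0 k).le (hq1 k)
  let R : ℕ → ProbabilityMeasure (Θ × ℝ≥0) := fun k =>
    ⟨mixture γ (ν : Measure (Θ × ℝ≥0)) (g k) (q k), hprob k⟩
  refine hC.mem_of_tendsto (f := R) (b := atTop) ?_ (Eventually.of_forall fun k => ?_)
  · rw [ProbabilityMeasure.tendsto_iff_forall_integral_tendsto]
    intro f
    have hval (k : ℕ) : ∫ p, f p ∂(R k : Measure (Θ × ℝ≥0)) =
        (1 - q k) * ∫ p, f (g k p) ∂(ν : Measure (Θ × ℝ≥0)) +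
          q k * ∫ p, f p ∂(γ.prod (Measure.dirac 0)) := by
      have := Measure.isProbabilityMeasure_map (μ := (ν : Measure (Θ × ℝ≥0)))
        (g k).measurable.aemeasurable
      change ∫ p, f p ∂(mixture γ (ν : Measure (Θ × ℝ≥0)) (g k) (q k)) = _
      rw [mixture, integral_add_measure ((f.integrable _).smul_measure ENNReal.ofReal_ne_top)
        ((f.integrable _).smul_measure ENNReal.ofReal_ne_top), integral_smul_measure,
        integral_smul_measure, ENNReal.toReal_ofReal (sub_nonneg.2 (hq1 k)),
        ENNReal.toReal_ofReal (hq0 k).le, integral_map (g k).measurable.aemeasurable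
        f.continuous.aestronglyMeasurable, smul_eq_mul, smul_eq_mul]
    simp_rw [hval]
    have hlim : Tendsto (fun k => ∫ p, f (g k p) ∂(ν : Measure (Θ × ℝ≥0))) atTop
        (𝓝 (∫ p, f p ∂(ν : Measure (Θ × ℝ≥0)))) := by
      refine tendsto_integral_of_dominated_convergence (fun _ => ‖f‖)
        (fun k => (f.continuous.measurable.comp (g k).measurable).aestronglyMeasurable)
        (integrable_const _) (fun k => ae_of_all _ fun p => f.norm_coe_le_norm _)
        (ae_of_all _ fun p => ?_)
      exact (f.continuous.tendsto p).comp
        (SimpleFunc.tendsto_approxOn measurable_id hp₀ (dense_sInf_lt hγ p))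
    simpa using (((tendsto_const_nhds (x := (1 : ℝ))).sub hqlim).mul hlim).add
      (hqlim.mul_const (∫ p, f p ∂(γ.prod (Measure.dirac 0))))
  · obtain ⟨m, φ, hm, hinj, hφ⟩ := exists_scales_mixture γ (ν : Measure (Θ × ℝ≥0)) (g k) (q k)
    exact hregular (R k) (isRegular_mixture hγ (hq0 k) (hq1 k) fun p =>
      SimpleFunc.approxOn_mem measurable_id hp₀ k p) m φ hm hinj hφ

end DSBA

/-! ### Assembly of the support theorem. -/

theorem theorem5 (Θ : Set ℝ) (hΘ_closed : IsClosed Θ) (hΘ_interval : Θ.OrdConnected)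
    (hΘ_nondegenerate : Θ.Nontrivial)
    -- the parameters: `H n j (2 l - 1)` is the measure `H_{j,2l-1}` of the collection `H_n`
    (H : ℕ → ℕ → ℕ → Measure Θ)
    (hH_prob : ∀ n j l : ℕ, 1 ≤ n → 1 ≤ j → j ≤ n + 1 → 1 ≤ l → l ≤ 2 ^ (j - 1) →
      IsProbabilityMeasure (H n j (2 * l - 1)))
    (hH_ac : ∀ n j l : ℕ, 1 ≤ n → 1 ≤ j → j ≤ n + 1 → 1 ≤ l → l ≤ 2 ^ (j - 1) →
      H n j (2 * l - 1) ≪ (volume : Measure ℝ).comap (Subtype.val : Θ → ℝ))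
    (hH_supp : ∀ n j l : ℕ, 1 ≤ n → 1 ≤ j → j ≤ n + 1 → 1 ≤ l → l ≤ 2 ^ (j - 1) →
      (H n j (2 * l - 1)).support = Set.univ)
    (Pη : Measure ℝ≥0) [IsProbabilityMeasure Pη] (hPη_supp : Pη.support = Set.univ)
    (α : (m : ℕ) → Fin m → ℝ) (hα : ∀ m i, 0 < α m i)
    -- the random levels `n` and `m₂`, with full support on the pairs of positive integers
    {Ω : Type*} [MeasurableSpace Ω] (P : Measure Ω) [IsProbabilityMeasure P]
    (N M : Ω → ℕ) (hN : Measurable N) (hM : Measurable M)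
    (hNM_pos : ∀ᵐ ω ∂P, 1 ≤ N ω ∧ 1 ≤ M ω)
    (hNM_supp : ∀ n m : ℕ, 1 ≤ n → 1 ≤ m → 0 < P {ω | N ω = n ∧ M ω = m})
    -- given `n` and `m₂`, the random measure `G` is a DSBASg
    (G : Ω → ProbabilityMeasure (Θ × ℝ≥0))
    (hG : ∀ n m : ℕ, 1 ≤ n → 1 ≤ m →
      HasLaw (fun ω => (G ω : Measure (Θ × ℝ≥0)))
        (DSBA.dsbasgLaw n (H n) Pη m (α m))
        (ProbabilityTheory.cond P {ω | N ω = n ∧ M ω = m})) :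
    (P.map G).support = Set.univ := by 
  obtain ⟨t₀, ht₀⟩ := hΘ_nondegenerate.nonempty
  have : Nonempty Θ := ⟨⟨t₀, ht₀⟩⟩
  have hA (n m : ℕ) : MeasurableSet {ω | N ω = n ∧ M ω = m} :=
    (hN (measurableSet_singleton n)).inter (hM (measurableSet_singleton m))
  have hGm : AEMeasurable G P := by
    -- Measurability of `G` is known only under the conditional laws, so it is glued over the
    -- countably many cells of `(N, M)`, which cover almost everything.
    have hcover : P.restrict (⋃ i : ℕ × ℕ, {ω | N ω = i.1 + 1 ∧ M ω = i.2 + 1}) = P := by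
      rw [Measure.restrict_eq_self_of_ae_mem]
      filter_upwards [hNM_pos] with ω hω
      refine Set.mem_iUnion.2 ⟨(N ω - 1, M ω - 1), ?_, ?_⟩
      · exact (Nat.sub_add_cancel hω.1).symm
      · exact (Nat.sub_add_cancel hω.2).symm
    rw [← hcover, aemeasurable_iUnion_iff]
    intro i
    refine (MeasurableEmbedding.subtype_coe
      ProbabilityMeasure.measurableSet_isProbabilityMeasure).aemeasurable_comp_iff.1 ?_
    have h := (hG (i.1 + 1) (i.2 + 1) (by omega) (by omega)).aemeasurable
    refine AEMeasurable.mono_ac h ?_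
    rw [ProbabilityTheory.cond]
    exact Measure.absolutelyContinuous_smul (ENNReal.inv_ne_zero.2 (measure_ne_top _ _))
  refine DSBA.eq_univ_of_isClosed_of_discretization_mem hΘ_closed hΘ_interval hΘ_nondegenerate
    Measure.isClosed_support fun ν hν m φ hm hinj hφ n hn Q hQ => ?_
  rw [Measure.mem_support_iff_forall]
  intro U hU
  have := ProbabilityTheory.cond_isProbabilityMeasure (hNM_supp n m hn hm).ne'
  have hlaw := hG n m hn hm
  obtain ⟨S, hS, hpos, hSU⟩ := DSBA.exists_measurableSet_dsbasgLaw_pos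
    (fun j l h1 h2 h3 h4 => have := hH_prob n j l hn h1 h2 h3 h4; inferInstance)
    (fun j l h1 h2 h3 h4 => hH_supp n j l hn h1 h2 h3 h4) hPη_supp (hα m)
    (DSBA.strictRow_sbaRow hΘ_closed hΘ_interval hΘ_nondegenerate hν (n + 1)) φ
    (DSBA.scaleWeight_mem_stdSimplex hΘ_closed hΘ_interval hΘ_nondegenerate hν hinj hφ n) hQ hU
  rw [← hlaw.map_eq, Measure.map_apply_of_aemeasurable hlaw.aemeasurable hS] at hpos
  -- This inequality holds for arbitrary sets, so `U` need not be measurable; positivity under the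
  -- conditional law then passes to `P` by absolute continuity.
  refine lt_of_lt_of_le ?_ (Measure.le_map_apply hGm U)
  refine lt_of_lt_of_le (ProbabilityTheory.cond_absolutelyContinuous.pos_mono hpos)
    (measure_mono fun ω hω => hSU (G ω) hω)
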